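/- Let $r\ge 1$, $2k\ge r+4$ and $n\ge 20(r+2)^2k$ be integers, and let $G$ be an $n$-vertex graph that contains no cycle $C_{2k+1}$ as a (not necessarily induced) subgraph and has $$e(G)\ \ge\ \Big\lfloor \frac{(n-r+1)^2}{4}\Big\rfloor+\binom r2 .$$ Write $d_2(G)=\min\{|T| : T\subseteq V(G),\ G-T\text{ is bipartite}\}$ and $\gamma_2(G)=\min\{|E| : E\subseteq E(G),\ G-E\text{ is bipartite}\}$. Then: (1) $G$ can be made bipartite by deleting at most $r-1$ vertices; that is, $d_2(G)\le r-1$. (2) $G$ can be made bipartite by deleting at most $\binom{\lceil r/2\rceil}{2}+\binom{\lfloor r/2\rfloor}{2}$ edges; that is, $\gamma_2(G)\le \binom{\lceil r/2\rceil}{2}+\binom{\lfloor r/2\rfloor}{2}$. (3) If moreover $r\ge 3$, then $\gamma_2(G)=\binom{\lceil r/2\rceil}{2}+\binom{\lfloor r/2\rfloor}{2}$ if and only if $G$ is a $T^*(r,n)$, that is, $G$ consists of a complete bipartite graph $K_{\lfloor (n-r+1)/2\rfloor,\lceil (n-r+1)/2\rceil}$ and a complete graph $K_r$ which share exactly one vertex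 (this vertex may lie in either part of the bipartite graph). -/

import Mathlib

/-- `d₂(G)`: the least number of vertices whose deletion leaves a bipartite graph. -/
noncomputable def d2 {V : Type*} (G : SimpleGraph V) : ℕ :=
  sInf {m | ∃ T : Finset V, T.card = m ∧ (G.induce {v | v ∉ T}).IsBipartite}

/-- `γ₂(G)`: the least number of edges whose deletion leaves a bipartite graph. -/
noncomputable def gamma2 {V : Type*} (G : SimpleGraph V) : ℕ :=
  sInf {m | ∃ E : Finset (Sym2 V), (E : Set (Sym2 V)) ⊆ G.edgeSet ∧ E.card = m ∧
    (G.deleteEdges (E : Set (Sym2 V))).IsBipartite}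

/-- `G` is (a copy of) `T*(r, n)`, where `n = |V(G)|`: it consists of a complete bipartite graph
with parts `A`, `B` of sizes `⌊(n-r+1)/2⌋`, `⌈(n-r+1)/2⌉` and a complete graph `K_r`, on the
vertex set `C ∪ {x}`, which share exactly one vertex `x`. The vertex `x` may lie in either part. -/
def IsTStar {V : Type*} [Fintype V] (r : ℕ) (G : SimpleGraph V) : Prop :=
  ∃ (A B C : Finset V) (x : V),
    Disjoint A B ∧ Disjoint A C ∧ Disjoint B C ∧ (∀ v, v ∈ A ∨ v ∈ B ∨ v ∈ C) ∧
    A.card = (Fintype.card V - r + 1) / 2 ∧ B.card = (Fintype.card V - r + 2) / 2 ∧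
    C.card + 1 = r ∧ (x ∈ A ∨ x ∈ B) ∧
    ∀ u v, G.Adj u v ↔ (u ∈ A ∧ v ∈ B) ∨ (u ∈ B ∧ v ∈ A) ∨
      (u ≠ v ∧ (u ∈ C ∨ u = x) ∧ (v ∈ C ∨ v = x))

/-- On a finite graph the minimum defining `d2` is attained. -/
theorem d2_spec {V : Type*} [Fintype V] (G : SimpleGraph V) :
    ∃ T : Finset V, T.card = d2 G ∧ (G.induce {v | v ∉ T}).IsBipartite := by
  refine Nat.sInf_mem (s := {m | ∃ T : Finset V, T.card = m ∧
    (G.induce {v | v ∉ T}).IsBipartite}) ⟨_, Finset.univ, rfl, ?_⟩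
  exact ⟨SimpleGraph.Coloring.mk (fun _ => 0) (fun {v} _ => absurd (Finset.mem_univ v.1) v.2)⟩

/-- On a finite graph the minimum defining `gamma2` is attained. -/
theorem gamma2_spec {V : Type*} [Fintype V] (G : SimpleGraph V) :
    ∃ E : Finset (Sym2 V), (E : Set (Sym2 V)) ⊆ G.edgeSet ∧ E.card = gamma2 G ∧
      (G.deleteEdges (E : Set (Sym2 V))).IsBipartite := by
  classical
  refine Nat.sInf_mem (s := {m | ∃ E : Finset (Sym2 V), (E : Set (Sym2 V)) ⊆ G.edgeSet ∧
    E.card = m ∧ (G.deleteEdges (E : Set (Sym2 V))).IsBipartite}) ⟨_, G.edgeFinset, ?_, rfl, ?_⟩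
  · simp
  · refine ⟨SimpleGraph.Coloring.mk (fun _ => 0) (fun {v w} h => ?_)⟩
    simp [SimpleGraph.deleteEdges_adj] at h

/-! All but at most `r - 1` vertices of `G` form a bipartite hub with such rich path connections
that its attachments to the rest are severely restricted. A set `W` maximizing `5 e(W) - 2 |W|² - 3
|W|` has minimum degree above `2 |W| / 5`. Of any three vertices of `W`, two then have many common
neighbours, which turns a triangle in `W` into a `C_{2k+1}`. So `W` is triangle-free, and bipartite
by Andrásfai–Erdős–Sós. Comparing edge counts shows that `W` misses at most `10 r` vertices. Adding
to each part the outside vertices with two neighbours in the opposite part keeps paths of length `2k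
- 2` within a part and `2k - 1` across (`IsHub`). A second edge count leaves a set `S` of at most `r
- 1` vertices, which proves (1). For (2), the vertices of `S` with at least two hub neighbours
extend the bipartition for free, and the others are coloured greedily. The cost telescopes to at
most `⌊(r-1)²/4⌋`, the claimed sum of binomials. For (3), a free set of two vertices would save an
edge. Hence `|S| = r - 1` and, by `bipartiteUpTo_pair_or`, `S` is a clique joined to a single hub
vertex; the edge count makes the hub complete and balanced. Conversely, `K_r` alone forces that many
deletions. -/

open Finset

/-! ### Paths of prescribed length from large codegrees. -/

namespace SimpleGraph
variable {V : Type*} {G : SimpleGraph V}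

/-- There is a path of length `ℓ` from `a` to `b` all of whose vertices lie in `W`. -/
def PathIn (G : SimpleGraph V) (ℓ : ℕ) (W : Finset V) (a b : V) : Prop :=
  ∃ p : G.Walk a b, p.IsPath ∧ p.length = ℓ ∧ ∀ v ∈ p.support, v ∈ W

theorem PathIn.mono {ℓ : ℕ} {W W' : Finset V} {a b : V} (h : G.PathIn ℓ W a b) (hW : W ⊆ W') :
    G.PathIn ℓ W' a b := by
  obtain ⟨p, hp, hl, hs⟩ := h
  exact ⟨p, hp, hl, fun v hv => hW (hs v hv)⟩

theorem PathIn.symm {ℓ : ℕ} {W : Finset V} {a b : V} (h : G.PathIn ℓ W a b) :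
    G.PathIn ℓ W b a := by
  obtain ⟨p, hp, hl, hs⟩ := h
  exact ⟨p.reverse, hp.reverse, by simpa using hl, fun v hv => hs v (by simpa using hv)⟩

theorem PathIn.cons [DecidableEq V] {ℓ : ℕ} {W : Finset V} {u a b : V} (h : G.PathIn ℓ W a b)
    (hu : u ∉ W) (hua : G.Adj u a) : G.PathIn (ℓ + 1) (insert u W) u b := by
  obtain ⟨p, hp, hl, hs⟩ := h
  refine ⟨.cons hua p, hp.cons fun h => hu (hs _ h), by simp [hl], fun v hv => ?_⟩
  rw [Walk.support_cons, List.mem_cons] at hv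
  rcases hv with rfl | hv
  · exact mem_insert_self _ _
  · exact mem_insert_of_mem (hs v hv)

/-- The two ends of a path with `m` vertices are not adjacent in a graph without `m`-cycles. -/
theorem PathIn.not_adj {ℓ : ℕ} {W : Finset V} {a b : V} (h : G.PathIn ℓ W a b) (hℓ : 2 ≤ ℓ)
    (hfree : (cycleGraph (ℓ + 1)).Free G) : ¬ G.Adj b a := by
  intro hab
  obtain ⟨p, hp, hl, -⟩ := h
  refine hfree ((cycleGraph_isContained_iff (by omega)).2 ⟨b, .cons hab p, ?_, by simp [hl]⟩)
  rw [Walk.cons_isCycle_iff]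
  refine ⟨hp, fun he => ?_⟩
  have := hp.length_eq_one_of_mem_edges (Sym2.eq_swap ▸ he)
  omega

/-- A sequence of vertices in which consecutive ones have many common neighbours inside `W`
extends to a path that is twice as long. -/
theorem PathIn.of_isChain [DecidableEq V] [DecidableRel G.Adj] {W : Finset V} {D : ℕ} (l : List V) :
    ∀ (a z : V) (F : Finset V), (a :: l).Nodup → (a :: l).getLast? = some z →
      (a :: l).IsChain (fun u v => D ≤ #{c ∈ W | G.Adj u c ∧ G.Adj v c}) →
      (∀ v ∈ a :: l, v ∈ W \ F) → #F + 2 * l.length ≤ D →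
      G.PathIn (2 * l.length) (W \ F) a z := by
  induction l with
  | nil =>
    intro a z F _ hz _ hm _
    obtain rfl : a = z := by simpa using hz
    exact ⟨.nil, by simp, by simp, fun v hv => hm v (by simpa using hv)⟩
  | cons b t ih =>
    intro a z F hnd hz hch hm hc
    rw [List.getLast?_cons_cons] at hz
    have hat : a ∉ b :: t := (List.nodup_cons.1 hnd).1
    rw [List.isChain_cons_cons] at hch
    have haF := hm a (by simp)
    rw [mem_sdiff] at haF
    obtain ⟨p, hp, hl, hs⟩ := ih b z (insert a F) (List.nodup_cons.1 hnd).2 hz hch.2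
      (fun v hv => by
        have h1 := hm v (List.mem_cons_of_mem _ hv)
        rw [mem_sdiff] at h1
        have : v ≠ a := fun h => hat (h ▸ hv)
        simp [h1, this])
      (by rw [card_insert_of_notMem haF.2]; simp at hc; omega)
    -- The connecting vertex must avoid `F` and the `2 * t.length + 1` vertices of the tail path;
    -- the budget `#F + 2 * l.length ≤ D` leaves exactly one to spare.
    have hlt : #(F ∪ p.support.toFinset) < #{c ∈ W | G.Adj a c ∧ G.Adj b c} := by
      have h1 := card_union_le F p.support.toFinset
      have h2 := p.support.toFinset_card_le
      rw [Walk.length_support, hl] at h2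
      simp at hc
      omega
    obtain ⟨c, hcm, hcn⟩ := exists_mem_notMem_of_card_lt_card hlt
    simp only [mem_filter, mem_union, not_or, List.mem_toFinset] at hcm hcn
    have hap : a ∉ p.support := fun h => by simpa using hs a h
    refine ⟨.cons hcm.2.1 (.cons hcm.2.2.symm p), (hp.cons hcn.2).cons ?_, by simp [hl]; omega, ?_⟩
    · rw [Walk.support_cons, List.mem_cons, not_or]
      exact ⟨hcm.2.1.ne, hap⟩
    · intro v hv
      rw [Walk.support_cons, Walk.support_cons, List.mem_cons, List.mem_cons] at hv
      rcases hv with rfl | rfl | hv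
      · simp [haF]
      · simp [hcm.1, hcn.1]
      · have := hs v hv
        simp at this ⊢
        tauto

/-- If any two vertices of `X` have many common neighbours then they are joined by paths of all
even lengths. -/
theorem PathIn.even [DecidableEq V] [DecidableRel G.Adj] {W X F : Finset V} {D i : ℕ} {a b : V}
    (hX : X ⊆ W) (hD : ∀ u ∈ X, ∀ v ∈ X, D ≤ #{c ∈ W | G.Adj u c ∧ G.Adj v c})
    (ha : a ∈ X) (hb : b ∈ X) (hab : a ≠ b) (haF : a ∉ F) (hbF : b ∉ F) (hi : 1 ≤ i)
    (hiX : #F + i + 1 ≤ #X) (hiD : #F + 2 * i ≤ D) : G.PathIn (2 * i) (W \ F) a b := by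
  have hc : i - 1 ≤ #(X \ insert a (insert b F)) := by
    have := le_card_sdiff (insert a (insert b F)) X
    have := card_insert_le a (insert b F)
    have := card_insert_le b F
    omega
  obtain ⟨M, hM, hMc⟩ := exists_subset_card_eq hc
  have hmem : ∀ v ∈ a :: (M.toList ++ [b]), v ∈ X ∧ v ∉ F := by
    intro v hv
    simp only [List.mem_cons, List.mem_append, mem_toList, List.not_mem_nil, or_false] at hv
    rcases hv with rfl | hv | rfl
    · exact ⟨ha, haF⟩
    · have := hM hv
      simp at this
      tauto
    · exact ⟨hb, hbF⟩
  have hnd : (a :: (M.toList ++ [b])).Nodup := by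
    have h1 : a ∉ M := fun h => by simpa using hM h
    have h2 : b ∉ M := fun h => by simpa using hM h
    simp [List.nodup_append, nodup_toList, h1, hab]
    exact h2
  have hlen : (M.toList ++ [b]).length = i := by simp [hMc]; omega
  have := PathIn.of_isChain (G := G) (W := W) (D := D) (M.toList ++ [b]) a b F hnd
    (by rw [← List.cons_append, List.getLast?_concat]) ?_ ?_ (by omega)
  · rw [hlen] at this
    simpa using this
  · refine List.Pairwise.isChain (List.Pairwise.imp_of_mem ?_ hnd)
    intro u v hu hv _
    exact hD u (hmem u hu).1 v (hmem v hv).1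
  · intro v hv
    exact mem_sdiff.2 ⟨hX (hmem v hv).1, (hmem v hv).2⟩

end SimpleGraph

/-! ### Long chains in a relation without independent triples. -/

/-- If any three elements of `S` contain a related pair, then `S` is covered by two chains. -/
theorem exists_two_isChain_of_forall_three {V : Type*} [DecidableEq V] {R : V → V → Prop}
    (hR : ∀ u v, R u v → R v u) (S : Finset V)
    (h : ∀ u ∈ S, ∀ v ∈ S, ∀ w ∈ S, R u v ∨ R u w ∨ R v w) :
    ∃ l₁ l₂ : List V, (l₁ ++ l₂).Nodup ∧ l₁.IsChain R ∧ l₂.IsChain R ∧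
      ∀ v, v ∈ l₁ ++ l₂ ↔ v ∈ S := by
  induction S using Finset.induction_on with
  | empty => exact ⟨[], [], by simp⟩
  | insert v S hv ih =>
    obtain ⟨l₁, l₂, hnd, h₁, h₂, hm⟩ := ih fun u hu v hv w hw =>
      h u (mem_insert_of_mem hu) v (mem_insert_of_mem hv) w (mem_insert_of_mem hw)
    have hv' : v ∉ l₁ ++ l₂ := fun hh => hv ((hm v).1 hh)
    have hm' : ∀ w, w ∈ v :: (l₁ ++ l₂) ↔ w ∈ insert v S := by
      intro w
      rw [List.mem_cons, hm, mem_insert]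
    have hnd' : (v :: (l₁ ++ l₂)).Nodup := List.nodup_cons.2 ⟨hv', hnd⟩
    have key : ∀ L₁ L₂ : List V, L₁.IsChain R → L₂.IsChain R →
        (L₁ ++ L₂).Perm (v :: (l₁ ++ l₂)) → ∃ l₁ l₂ : List V, (l₁ ++ l₂).Nodup ∧
          l₁.IsChain R ∧ l₂.IsChain R ∧ ∀ w, w ∈ l₁ ++ l₂ ↔ w ∈ insert v S :=
      fun L₁ L₂ c₁ c₂ hp => ⟨L₁, L₂, hp.nodup_iff.2 hnd', c₁, c₂, fun w => by
        rw [hp.mem_iff, hm']⟩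
    have hp2 : (l₁ ++ [v] ++ l₂).Perm (v :: (l₁ ++ l₂)) := by simp
    cases hl₁ : l₁ with
    | nil => exact key [v] l₂ (by simp) h₂ (by simp [hl₁])
    | cons p t =>
      cases hl₂ : l₂ with
      | nil => exact key l₁ [v] h₁ (by simp) (by simp [hl₂])
      | cons q t' =>
        have hpS : p ∈ S := (hm p).1 (by simp [hl₁])
        have hqS : q ∈ S := (hm q).1 (by simp [hl₂])
        -- Either `v` extends a chain at its head, or the heads `p`, `q` are related; then the first
        -- chain is reversed and glued to the second, and `v` starts a new one.
        rcases h v (mem_insert_self _ _) p (mem_insert_of_mem hpS) q (mem_insert_of_mem hqS)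
          with hvp | hvq | hpq
        · exact key (v :: l₁) l₂ (by rw [hl₁] at h₁ ⊢; exact h₁.cons_cons hvp) h₂ (by simp)
        · exact key l₁ (v :: l₂) h₁ (by rw [hl₂] at h₂ ⊢; exact h₂.cons_cons hvq)
            (by simp)
        · refine key [v] (l₁.reverse ++ l₂) (by simp) ?_ ?_
          · refine List.IsChain.append ?_ h₂ ?_
            · rw [List.isChain_reverse]
              exact h₁.imp fun a b => hR a b
            · simp [hl₁, hl₂, hpq]
          · simp [List.perm_append_right_iff, List.reverse_perm]

theorem exists_isChain_of_forall_three {V : Type*} [DecidableEq V] {R : V → V → Prop}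
    (hR : ∀ u v, R u v → R v u) (S : Finset V)
    (h : ∀ u ∈ S, ∀ v ∈ S, ∀ w ∈ S, R u v ∨ R u w ∨ R v w) {k : ℕ} (hk : 2 * k ≤ #S) :
    ∃ l : List V, l.Nodup ∧ l.IsChain R ∧ l.length = k ∧ ∀ v ∈ l, v ∈ S := by
  obtain ⟨l₁, l₂, hnd, h₁, h₂, hm⟩ := exists_two_isChain_of_forall_three hR S h
  have hc : (l₁ ++ l₂).length = #S := by
    rw [← List.toFinset_card_of_nodup hnd]
    congr 1
    ext v
    rw [List.mem_toFinset, hm]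
  rw [List.length_append] at hc
  rcases le_or_gt k l₁.length with hk₁ | hk₁
  · exact ⟨l₁.take k, (List.nodup_append.1 hnd).1.sublist (List.take_sublist _ _), h₁.take k,
      by simpa using hk₁, fun v hv => (hm v).1 (List.mem_append_left _ (List.mem_of_mem_take hv))⟩
  · exact ⟨l₂.take k, (List.nodup_append.1 hnd).2.1.sublist (List.take_sublist _ _), h₂.take k,
      by simp; omega,
      fun v hv => (hm v).1 (List.mem_append_right _ (List.mem_of_mem_take hv))⟩

/-! ### Large minimum degree without `C_{2k+1}` forces bipartiteness. -/

namespace SimpleGraph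
variable {V : Type*} {G : SimpleGraph V} [DecidableRel G.Adj]

theorem degree_induce_eq_card_filter (W : Finset V) (v : V) (hv : v ∈ W) :
    (G.induce (W : Set V)).degree ⟨v, hv⟩ = #{c ∈ W | G.Adj v c} := by
  rw [← card_neighborFinset_eq_degree]
  refine card_bij (fun c _ => c.1) ?_ ?_ ?_
  · intro c hc
    simpa using hc
  · intro a _ b _ h
    exact Subtype.ext h
  · intro b hb
    rw [mem_filter] at hb
    exact ⟨⟨b, hb.1⟩, by simpa using hb.2, rfl⟩

variable [DecidableEq V]

/-- The three neighbourhoods have total size above `6/5 |W|`, so their pairwise intersections have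
total size above `|W| / 5 ≥ 3 D`. -/
theorem exists_codegree_of_minDegree {W : Finset V} {D : ℕ} (hD : 15 * D ≤ #W)
    (hdeg : ∀ v ∈ W, 2 * #W < 5 * #{c ∈ W | G.Adj v c}) {u v w : V} (hu : u ∈ W) (hv : v ∈ W)
    (hw : w ∈ W) : D ≤ #{c ∈ W | G.Adj u c ∧ G.Adj v c} ∨
      D ≤ #{c ∈ W | G.Adj u c ∧ G.Adj w c} ∨ D ≤ #{c ∈ W | G.Adj v c ∧ G.Adj w c} := by
  simp only [filter_and]
  have h1 := hdeg u hu
  have h2 := hdeg v hv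
  have h3 := hdeg w hw
  set A := {c ∈ W | G.Adj u c}
  set B := {c ∈ W | G.Adj v c}
  set C := {c ∈ W | G.Adj w c}
  have e1 := card_union_add_card_inter A B
  have e2 := card_union_add_card_inter (A ∪ B) C
  have e3 : #((A ∪ B) ∩ C) ≤ #(A ∩ C) + #(B ∩ C) := by
    rw [union_inter_distrib_right]
    exact card_union_le _ _
  have e4 : #(A ∪ B ∪ C) ≤ #W :=
    card_le_card (union_subset (union_subset (filter_subset _ _) (filter_subset _ _))
      (filter_subset _ _))
  omega

/-- Among `2k` common neighbours of `x` and `y` there is a chain of `k` with consecutive large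
codegrees. It yields a path of length `2k - 2` avoiding `x` and `y`, and the edge `xy` closes it to
a `C_{2k+1}`. -/
theorem not_free_of_adj_of_codegree {W : Finset V} {k : ℕ} (hk : 2 ≤ k)
    (hW : 15 * (2 * k + 2) ≤ #W) (hdeg : ∀ v ∈ W, 2 * #W < 5 * #{c ∈ W | G.Adj v c})
    (hfree : (cycleGraph (2 * k + 1)).Free G) {x y : V} (hxy : G.Adj x y) :
    #{c ∈ W | G.Adj x c ∧ G.Adj y c} < 2 * k := by
  by_contra! hc
  obtain ⟨l, hnd, hch, hlen, hm⟩ := exists_isChain_of_forall_three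
    (R := fun u v => 2 * k + 2 ≤ #{c ∈ W | G.Adj u c ∧ G.Adj v c})
    (fun u v h => by simpa only [and_comm] using h) {c ∈ W | G.Adj x c ∧ G.Adj y c}
    (fun u hu v hv w hw => exists_codegree_of_minDegree hW hdeg (mem_filter.1 hu).1
      (mem_filter.1 hv).1 (mem_filter.1 hw).1) hc
  obtain _ | ⟨a, t⟩ := l
  · simp at hlen
    omega
  have ht : t.length + 1 = k := by simpa using hlen
  obtain ⟨z, hz⟩ : ∃ z, (a :: t).getLast? = some z := ⟨_, List.getLast?_eq_some_getLast (by simp)⟩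
  have hzm := hm z (List.mem_of_getLast? hz)
  have ham := hm a (by simp)
  simp only [mem_filter] at hzm ham
  have hp := PathIn.of_isChain t a z {x, y} hnd hz hch (fun v hv => by
      have := hm v hv
      rw [mem_filter] at this
      have h1 := this.2.1.ne'
      have h2 := this.2.2.ne'
      simp [this.1, h1, h2]) (by
      have := card_le_two (a := x) (b := y)
      omega)
  have h1 := (hp.cons (u := x) (by simp) ham.2.1).cons (u := y) (by simp [hxy.ne']) hxy.symm
  have e : 2 * t.length + 1 + 1 = 2 * k := by omega
  rw [e] at h1
  exact h1.not_adj (by omega) hfree hzm.2.2.symm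

/-- A graph of large minimum degree without a cycle of length `2k + 1` is bipartite. -/
theorem exists_bipartition_of_minDegree {W : Finset V} {k : ℕ} (hk : 2 ≤ k)
    (hW : 15 * (2 * k + 2) ≤ #W) (hdeg : ∀ v ∈ W, 2 * #W < 5 * #{c ∈ W | G.Adj v c})
    (hfree : (cycleGraph (2 * k + 1)).Free G) :
    ∃ X Y : Finset V, X ∪ Y = W ∧ Disjoint X Y ∧ (∀ u ∈ X, ∀ v ∈ X, ¬ G.Adj u v) ∧
      ∀ u ∈ Y, ∀ v ∈ Y, ¬ G.Adj u v := by
  -- Two vertices of a triangle would have codegree at least `2k + 2`, too much for an edge.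
  have hcf : (G.induce (W : Set V)).CliqueFree (2 + 1) := by
    intro s hs
    obtain ⟨⟨a, ha⟩, ⟨b, hb⟩, ⟨c, hc⟩, hab, hac, hbc, -⟩ := is3Clique_iff.1 hs
    simp only [comap_adj, Function.Embedding.subtype_apply] at hab hac hbc
    have h1 := not_free_of_adj_of_codegree hk hW hdeg hfree hab
    have h2 := not_free_of_adj_of_codegree hk hW hdeg hfree hac
    have h3 := not_free_of_adj_of_codegree hk hW hdeg hfree hbc
    have := exists_codegree_of_minDegree hW hdeg ha hb hc
    omega
  have hne : W.Nonempty := card_pos.1 (by omega)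
  have : Nonempty (W : Set V) := hne.to_subtype
  have hcol : (G.induce (W : Set V)).Colorable 2 := by
    -- The Andrásfai–Erdős–Sós theorem for triangle-free graphs.
    refine colorable_of_cliqueFree_lt_minDegree hcf ?_
    have : 2 * #W / 5 + 1 ≤ (G.induce (W : Set V)).minDegree := by
      refine le_minDegree_of_forall_le_degree _ _ fun v => ?_
      have := hdeg v.1 v.2
      rw [← degree_induce_eq_card_filter W v.1 v.2] at this
      have h : (⟨v.1, v.2⟩ : (W : Set V)) = v := rfl
      rw [h] at this
      omega
    simp
    omega
  obtain ⟨c⟩ := hcol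
  refine ⟨{v ∈ W | ∃ h : v ∈ W, c ⟨v, h⟩ = 0}, {v ∈ W | ¬ ∃ h : v ∈ W, c ⟨v, h⟩ = 0},
    filter_union_filter_not_eq _ _, disjoint_filter_filter_not _ _ _, ?_, ?_⟩
  · rintro u hu v hv huv
    obtain ⟨hu, h1⟩ := (mem_filter.1 hu).2
    obtain ⟨hv, h2⟩ := (mem_filter.1 hv).2
    exact c.valid (v := ⟨u, hu⟩) (w := ⟨v, hv⟩) huv (h1.trans h2.symm)
  · rintro u hu v hv huv
    obtain ⟨hu, h1⟩ := mem_filter.1 hu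
    obtain ⟨hv, h2⟩ := mem_filter.1 hv
    have h1 : c ⟨u, hu⟩ ≠ 0 := fun h => h1 ⟨hu, h⟩
    have h2 : c ⟨v, hv⟩ ≠ 0 := fun h => h2 ⟨hv, h⟩
    have := c.valid (v := ⟨u, hu⟩) (w := ⟨v, hv⟩) huv
    omega

end SimpleGraph

/-! ### Edge counting and the bipartite core. -/

namespace SimpleGraph
variable {V : Type*} {G : SimpleGraph V} [DecidableRel G.Adj]

/-- Twice the number of edges inside `insert v T`. -/
theorem sum_card_filter_adj_insert [DecidableEq V] {T : Finset V} {v : V} (hv : v ∉ T) :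
    ∑ u ∈ insert v T, #{c ∈ insert v T | G.Adj u c} =
      ∑ u ∈ T, #{c ∈ T | G.Adj u c} + 2 * #{c ∈ insert v T | G.Adj v c} := by
  have h : ∑ u ∈ T, (if G.Adj u v then 1 else 0) = ∑ u ∈ T, (if G.Adj v u then 1 else 0) :=
    sum_congr rfl fun u _ => by simp only [G.adj_comm]
  simp only [card_filter, sum_insert hv, sum_add_distrib, SimpleGraph.irrefl, if_false, h]
  ring

theorem sum_card_filter_adj_le_mul_self (W : Finset V) :
    ∑ u ∈ W, #{c ∈ W | G.Adj u c} ≤ #W * #W := by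
  rw [← smul_eq_mul]
  exact sum_le_card_nsmul _ _ _ fun u _ => card_le_card (filter_subset _ _)

theorem sum_card_filter_adj_union_le [DecidableEq V] {X Y : Finset V} (hXY : Disjoint X Y)
    (hX : ∀ u ∈ X, ∀ v ∈ X, ¬ G.Adj u v) (hY : ∀ u ∈ Y, ∀ v ∈ Y, ¬ G.Adj u v) :
    ∑ u ∈ X ∪ Y, #{c ∈ X ∪ Y | G.Adj u c} ≤ 2 * (#X * #Y) := by
  rw [sum_union hXY]
  have h1 : ∑ u ∈ X, #{c ∈ X ∪ Y | G.Adj u c} ≤ #X * #Y := by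
    rw [← smul_eq_mul]
    refine sum_le_card_nsmul _ _ _ fun u hu => card_le_card fun c hc => ?_
    rw [mem_filter, mem_union] at hc
    exact hc.1.resolve_left fun h => hX u hu c h hc.2
  have h2 : ∑ u ∈ Y, #{c ∈ X ∪ Y | G.Adj u c} ≤ #Y * #X := by
    rw [← smul_eq_mul]
    refine sum_le_card_nsmul _ _ _ fun u hu => card_le_card fun c hc => ?_
    rw [mem_filter, mem_union] at hc
    exact hc.1.resolve_right fun h => hY u hu c h hc.2
  linarith [mul_comm #X #Y]

variable [Fintype V]

theorem sum_card_filter_adj_univ :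
    ∑ u : V, #{c | G.Adj u c} = 2 * #G.edgeFinset := by
  rw [← sum_degrees_eq_twice_card_edges]
  exact sum_congr rfl fun u _ => by
    rw [← card_neighborFinset_eq_degree, neighborFinset_eq_filter]

/-- A set maximizing `5 e(W) - 2 |W|² - 3 |W|` (`e` counting ordered pairs) has large minimum
degree. -/
theorem exists_minDegree_subset [DecidableEq V] : ∃ W : Finset V,
    (∀ v ∈ W, 2 * #W < 5 * #{c ∈ W | G.Adj v c}) ∧
    10 * (#G.edgeFinset : ℤ) - 2 * (Fintype.card V : ℤ) ^ 2 - 3 * (Fintype.card V : ℤ) ≤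
      5 * ((∑ u ∈ W, #{c ∈ W | G.Adj u c} : ℕ) : ℤ) - 2 * (#W : ℤ) ^ 2 - 3 * #W := by
  obtain ⟨W, hW⟩ := Finite.exists_max fun W : Finset V =>
    5 * ((∑ u ∈ W, #{c ∈ W | G.Adj u c} : ℕ) : ℤ) - 2 * (#W : ℤ) ^ 2 - 3 * #W
  refine ⟨W, fun v hv => ?_, ?_⟩
  -- Maximality against deleting `v` reads `10 d(v) ≥ 4 |W| + 1`; the linear term `3 |W|` is what
  -- makes the degree bound strict.
  · have h := hW (W.erase v)
    have h2 := sum_card_filter_adj_insert (G := G) (notMem_erase v W)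
    have h3 := card_erase_add_one hv
    rw [insert_erase hv] at h2
    rw [h2, ← h3] at h
    push_cast at h
    rw [← h3]
    zify
    nlinarith
  · have h := hW univ
    rw [sum_card_filter_adj_univ, card_univ] at h
    push_cast at h
    push_cast
    linarith

/-- A large bipartite piece of large minimum degree. -/
structure IsCore (G : SimpleGraph V) [DecidableEq V] [DecidableRel G.Adj] (k : ℕ)
    (X Y : Finset V) : Prop where
  disjoint : Disjoint X Y
  indep_left : ∀ u ∈ X, ∀ v ∈ X, ¬ G.Adj u v
  indep_right : ∀ u ∈ Y, ∀ v ∈ Y, ¬ G.Adj u v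
  deg : ∀ v ∈ X ∪ Y, 2 * #(X ∪ Y) < 5 * #{c ∈ X ∪ Y | G.Adj v c}
  card : 45 * k ≤ #(X ∪ Y)

/-- With `m = |W|`, the trivial bound on `e(W)` already forces `m ≥ 45 k`, so `W` is bipartite. The
sharper bound `m² / 2` on ordered adjacent pairs then gives `(n - m)(n + m - 6) ≤ 10 (r - 1) n +
15`, impossible when `n - m > 10 r`. -/
theorem exists_isCore [DecidableEq V] {r k n : ℕ} (hr : 1 ≤ r) (hk : r + 4 ≤ 2 * k)
    (hn : 20 * (r + 2) ^ 2 * k ≤ n) (hV : Fintype.card V = n)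
    (hfree : (cycleGraph (2 * k + 1)).Free G)
    (he : (n - r + 1) ^ 2 / 4 + r.choose 2 ≤ #G.edgeFinset) :
    ∃ X Y : Finset V, G.IsCore k X Y ∧ n ≤ #(X ∪ Y) + 10 * r := by
  obtain ⟨W, hdeg, hΦ⟩ := exists_minDegree_subset (G := G)
  rw [hV] at hΦ
  have hmn : #W ≤ n := hV ▸ card_le_univ W
  have hn1 : 180 * k ≤ n := by nlinarith [Nat.mul_le_mul_right k (show 9 ≤ (r + 2) ^ 2 by nlinarith)]
  have he' : ((n : ℤ) - r + 1) ^ 2 - 3 ≤ 4 * #G.edgeFinset := by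
    have h1 : (n - r + 1) ^ 2 ≤ 4 * #G.edgeFinset + 3 := by omega
    zify [show r ≤ n by omega] at h1
    linarith
  have hΦ' : (n : ℤ) ^ 2 - 10 * (r - 1) * n - 6 * n - 15 ≤
      10 * ((∑ u ∈ W, #{c ∈ W | G.Adj u c} : ℕ) : ℤ) - 4 * (#W : ℤ) ^ 2 - 6 * #W := by
    nlinarith [sq_nonneg ((r : ℤ) - 1)]
  have hk3 : 3 ≤ k := by omega
  have hcard : 45 * k ≤ #W := by
    by_contra! hlt
    have h1 := sum_card_filter_adj_le_mul_self (G := G) W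
    zify at h1 hlt hn1 hk hk3 hr
    have h2 : (n : ℤ) * (80 * k) ≤ n * (n - 10 * (r - 1) - 6) :=
      mul_le_mul_of_nonneg_left (by linarith) (by positivity)
    push_cast at hΦ'
    nlinarith
  obtain ⟨X, Y, rfl, hXY, hX, hY⟩ := exists_bipartition_of_minDegree (by omega) (by omega) hdeg hfree
  refine ⟨X, Y, ⟨hXY, hX, hY, hdeg, hcard⟩, ?_⟩
  by_contra! hlt
  have h1 := sum_card_filter_adj_union_le hXY hX hY
  have h2 := card_union_of_disjoint hXY
  set m := #(X ∪ Y)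
  zify at h1 h2 hlt hn1 hk hk3 hr hcard hmn
  have h3 : 2 * ((∑ u ∈ X ∪ Y, #{c ∈ X ∪ Y | G.Adj u c} : ℕ) : ℤ) ≤ (m : ℤ) ^ 2 := by
    push_cast
    rw [h2]
    nlinarith [sq_nonneg ((#X : ℤ) - #Y)]
  have h4 : ((n : ℤ) - m) * (n + m - 6) ≤ 10 * (r - 1) * n + 15 := by nlinarith
  have h5 : (10 * (r : ℤ) + 1) * n ≤ (n - m) * (n + m - 6) :=
    mul_le_mul (by linarith) (by linarith) (by positivity) (by linarith)
  nlinarith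

end SimpleGraph

/-! ### Hubs, and enlarging the core to a hub. -/

namespace SimpleGraph
variable {V : Type*} [DecidableEq V] {G : SimpleGraph V}

/-- A bipartite piece in which vertices of the same part are joined by paths of length `2k - 2` and
vertices of different parts are joined by paths of length `2k - 1`. -/
structure IsHub (G : SimpleGraph V) (k : ℕ) (X Y : Finset V) : Prop where
  disjoint : Disjoint X Y
  indep_left : ∀ u ∈ X, ∀ v ∈ X, ¬ G.Adj u v
  indep_right : ∀ u ∈ Y, ∀ v ∈ Y, ¬ G.Adj u v
  even_left : ∀ a ∈ X, ∀ b ∈ X, a ≠ b → G.PathIn (2 * k - 2) (X ∪ Y) a b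
  even_right : ∀ a ∈ Y, ∀ b ∈ Y, a ≠ b → G.PathIn (2 * k - 2) (X ∪ Y) a b
  odd : ∀ a ∈ X, ∀ b ∈ Y, G.PathIn (2 * k - 1) (X ∪ Y) a b

namespace IsHub
variable {k : ℕ} {X Y : Finset V}

theorem symm (h : G.IsHub k X Y) : G.IsHub k Y X where
  disjoint := h.disjoint.symm
  indep_left := h.indep_right
  indep_right := h.indep_left
  even_left := by rw [union_comm]; exact h.even_right
  even_right := by rw [union_comm]; exact h.even_left
  odd := fun a ha b hb => by rw [union_comm]; exact (h.odd b hb a ha).symm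

theorem not_adj_both (h : G.IsHub k X Y) (hk : 2 ≤ k) (hfree : (cycleGraph (2 * k + 1)).Free G)
    {u a b : V} (hu : u ∉ X ∪ Y) (ha : a ∈ X) (hb : b ∈ Y) (hua : G.Adj u a) : ¬ G.Adj u b := by
  intro hub
  have h1 := (h.odd a ha b hb).cons hu hua
  rw [show 2 * k - 1 + 1 = 2 * k by omega] at h1
  exact h1.not_adj (by omega) hfree hub.symm

/-- Otherwise the path of length `2k - 2` from `a` to `b` closes up through `v` and `u` to a
`C_{2k+1}`. -/
theorem eq_of_adj_right (h : G.IsHub k X Y) (hk : 2 ≤ k) (hfree : (cycleGraph (2 * k + 1)).Free G)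
    {u v a b : V} (hu : u ∉ X ∪ Y) (hv : v ∉ X ∪ Y) (huv : G.Adj u v) (ha : a ∈ Y) (hb : b ∈ Y)
    (hua : G.Adj u a) (hvb : G.Adj v b) : a = b := by
  by_contra hab
  have h1 := ((h.even_right a ha b hb hab).cons hu hua).cons (u := v)
    (by rw [mem_insert, not_or]; exact ⟨huv.ne', hv⟩) huv.symm
  rw [show 2 * k - 2 + 1 + 1 = 2 * k by omega] at h1
  exact h1.not_adj (by omega) hfree hvb.symm

theorem eq_of_adj_left (h : G.IsHub k X Y) (hk : 2 ≤ k) (hfree : (cycleGraph (2 * k + 1)).Free G)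
    {u v a b : V} (hu : u ∉ X ∪ Y) (hv : v ∉ X ∪ Y) (huv : G.Adj u v) (ha : a ∈ X) (hb : b ∈ X)
    (hua : G.Adj u a) (hvb : G.Adj v b) : a = b :=
  h.symm.eq_of_adj_right hk hfree (by rwa [union_comm]) (by rwa [union_comm]) huv ha hb hua hvb

end IsHub

namespace IsCore
variable [DecidableRel G.Adj] {k : ℕ} {X Y : Finset V}

theorem symm (h : G.IsCore k X Y) : G.IsCore k Y X where
  disjoint := h.disjoint.symm
  indep_left := h.indep_right
  indep_right := h.indep_left
  deg := by rw [union_comm]; exact h.deg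
  card := by rw [union_comm]; exact h.card

theorem filter_subset_right (h : G.IsCore k X Y) {v : V} (hv : v ∈ X) :
    {c ∈ X ∪ Y | G.Adj v c} ⊆ Y := fun c hc => by
  rw [mem_filter, mem_union] at hc
  exact hc.1.resolve_left fun hcX => h.indep_left v hv c hcX hc.2

theorem card_right_of_mem (h : G.IsCore k X Y) {v : V} (hv : v ∈ X) :
    2 * #(X ∪ Y) < 5 * #Y := by
  have h1 := h.deg v (mem_union_left _ hv)
  have h2 := card_le_card (h.filter_subset_right hv)
  omega

theorem card_right (h : G.IsCore k X Y) (hk : 1 ≤ k) : 2 * #(X ∪ Y) < 5 * #Y := by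
  obtain ⟨v, hv⟩ : (X ∪ Y).Nonempty := card_pos.1 (by have := h.card; omega)
  rcases mem_union.1 hv with hv | hv
  · exact h.card_right_of_mem hv
  · have h1 := h.symm.card_right_of_mem hv
    obtain ⟨w, hw⟩ : X.Nonempty := card_pos.1 (by omega)
    exact h.card_right_of_mem hw

theorem card_left (h : G.IsCore k X Y) (hk : 1 ≤ k) : 2 * #(X ∪ Y) < 5 * #X := by
  have := h.symm.card_right hk
  rwa [union_comm] at this

/-- Both neighbourhoods exceed `2/5` of the core and lie in `Y`, which is less than `3/5` of it;
they share more than a fifth, hence more than `9k` vertices. -/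
theorem codegree (h : G.IsCore k X Y) (hk : 1 ≤ k) {u v : V} (hu : u ∈ X) (hv : v ∈ X) :
    2 * k + 1 ≤ #{c ∈ X ∪ Y | G.Adj u c ∧ G.Adj v c} := by
  rw [filter_and]
  change _ ≤ #({c ∈ X ∪ Y | G.Adj u c} ∩ {c ∈ X ∪ Y | G.Adj v c})
  have h1 := card_union_add_card_inter {c ∈ X ∪ Y | G.Adj u c} {c ∈ X ∪ Y | G.Adj v c}
  have h2 := card_le_card (union_subset (h.filter_subset_right hu) (h.filter_subset_right hv))
  have h3 := h.deg u (mem_union_left _ hu)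
  have h4 := h.deg v (mem_union_left _ hv)
  have h5 := card_union_of_disjoint h.disjoint
  have h6 := h.card_left hk
  have h7 := h.card
  omega

/-- The one forbidden vertex serves `odd`, where the path must avoid `b` before its last edge
reaches it. -/
theorem even_left (h : G.IsCore k X Y) {i : ℕ} (hi : 1 ≤ i) (hik : i ≤ k) {F : Finset V}
    (hF : #F ≤ 1) {a b : V} (ha : a ∈ X) (hb : b ∈ X) (hab : a ≠ b) (haF : a ∉ F) (hbF : b ∉ F) :
    G.PathIn (2 * i) ((X ∪ Y) \ F) a b := by
  have h1 := h.card_left (by omega)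
  have h2 := h.card
  exact PathIn.even subset_union_left (fun u hu v hv => h.codegree (by omega) hu hv) ha hb hab
    haF hbF hi (by omega) (by omega)

theorem odd (h : G.IsCore k X Y) {i : ℕ} (hi : 1 ≤ i) (hik : i ≤ k) {a b : V} (ha : a ∈ X)
    (hb : b ∈ Y) : G.PathIn (2 * i + 1) (X ∪ Y) a b := by
  have h1 := h.deg b (mem_union_right _ hb)
  have h2 := h.card
  obtain ⟨c, hc, hca⟩ := exists_mem_ne (s := {c ∈ X ∪ Y | G.Adj b c}) (by omega) a
  have hcX : c ∈ X := by
    rw [mem_filter, mem_union] at hc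
    exact hc.1.resolve_right fun hcY => h.indep_right b hb c hcY hc.2
  have hne : ∀ x ∈ X, x ≠ b := fun x hx hxb => Finset.disjoint_left.1 h.disjoint hx (hxb ▸ hb)
  have h3 := h.even_left hi hik (F := {b}) (by simp) hcX ha hca (by simpa using hne c hcX)
    (by simpa using hne a ha)
  refine ((h3.cons (u := b) (by simp) (mem_filter.1 hc).2).mono ?_).symm
  exact insert_subset (mem_union_right _ hb) sdiff_subset

theorem even (h : G.IsCore k X Y) {i : ℕ} (hi : 1 ≤ i) (hik : i ≤ k) {a b : V} (ha : a ∈ X)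
    (hb : b ∈ X) (hab : a ≠ b) : G.PathIn (2 * i) (X ∪ Y) a b := by
  simpa using h.even_left hi hik (F := ∅) (by simp) ha hb hab (by simp) (by simp)

theorem isHub (h : G.IsCore k X Y) (hk : 2 ≤ k) : G.IsHub k X Y where
  disjoint := h.disjoint
  indep_left := h.indep_left
  indep_right := h.indep_right
  even_left := fun a ha b hb hab => by
    rw [show 2 * k - 2 = 2 * (k - 1) by omega]
    exact h.even (by omega) (by omega) ha hb hab
  even_right := fun a ha b hb hab => by
    rw [show 2 * k - 2 = 2 * (k - 1) by omega, union_comm]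
    exact h.symm.even (by omega) (by omega) ha hb hab
  odd := fun a ha b hb => by
    rw [show 2 * k - 1 = 2 * (k - 1) + 1 by omega]
    exact h.odd (by omega) (by omega) ha hb

end IsCore

theorem exists_adj_ne_of_two_le {V : Type*} {G : SimpleGraph V} [DecidableRel G.Adj]
    {Y : Finset V} {u : V} (hu : 2 ≤ #{c ∈ Y | G.Adj u c}) (z : V) :
    ∃ y ∈ Y, G.Adj u y ∧ y ≠ z := by
  obtain ⟨y, hy, hyz⟩ := exists_mem_ne (s := {c ∈ Y | G.Adj u c}) (by omega) z
  rw [mem_filter] at hy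
  exact ⟨y, hy.1, hy.2, hyz⟩

/-- `X` together with the vertices outside `X ∪ Y` that have at least two neighbours in `Y`. -/
def extendPart [Fintype V] (G : SimpleGraph V) [DecidableRel G.Adj] (X Y : Finset V) : Finset V :=
  X ∪ ({u | u ∉ X ∪ Y ∧ 2 ≤ #{c ∈ Y | G.Adj u c}} : Finset V)

namespace IsCore
variable [Fintype V] [DecidableRel G.Adj] {k : ℕ} {X Y : Finset V}

theorem subset_extendPart : X ⊆ G.extendPart X Y := subset_union_left

theorem mem_extendPart {u : V} :
    u ∈ G.extendPart X Y ↔ u ∈ X ∨ u ∉ X ∪ Y ∧ 2 ≤ #{c ∈ Y | G.Adj u c} := by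
  simp [extendPart]

/-- Two neighbours in `Y` allow the ends of an edge between added vertices to attach at distinct
points, against `eq_of_adj_right`. An edge from an added vertex to `X` is excluded by
`not_adj_both`. -/
theorem indep_extendPart (h : G.IsCore k X Y) (hk : 2 ≤ k)
    (hfree : (cycleGraph (2 * k + 1)).Free G) :
    ∀ u ∈ G.extendPart X Y, ∀ v ∈ G.extendPart X Y, ¬ G.Adj u v := by
  intro u hu v hv huv
  have H := h.isHub hk
  rw [mem_extendPart] at hu hv
  rcases hu with hu | ⟨hu, hu2⟩ <;> rcases hv with hv | ⟨hv, hv2⟩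
  · exact h.indep_left u hu v hv huv
  · obtain ⟨y, hy, hvy, -⟩ := exists_adj_ne_of_two_le hv2 v
    exact H.not_adj_both hk hfree hv hu hy huv.symm hvy
  · obtain ⟨y, hy, huy, -⟩ := exists_adj_ne_of_two_le hu2 v
    exact H.not_adj_both hk hfree hu hv hy huv huy
  · obtain ⟨y, hy, huy, -⟩ := exists_adj_ne_of_two_le hu2 v
    obtain ⟨z, hz, hvz, hzy⟩ := exists_adj_ne_of_two_le hv2 y
    exact hzy (H.eq_of_adj_right hk hfree hu hv huv hy hz huy hvz).symm

/-- Each added end spends one edge entering the core, at distinct points if both are added. The rest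
is a core path, of length at least `2k - 4`; hence `k ≥ 3`. -/
theorem even_extendPart (h : G.IsCore k X Y) (hk : 3 ≤ k) {a b : V} (ha : a ∈ G.extendPart X Y)
    (hb : b ∈ G.extendPart X Y) (hab : a ≠ b) :
    G.PathIn (2 * k - 2) (insert a (insert b (X ∪ Y))) a b := by
  have hone : ∀ u ∉ X ∪ Y, 2 ≤ #{c ∈ Y | G.Adj u c} → ∀ x ∈ X,
      G.PathIn (2 * k - 2) (insert u (X ∪ Y)) u x := by
    intro u hu hu2 x hx
    obtain ⟨y, hy, huy, -⟩ := exists_adj_ne_of_two_le hu2 x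
    have := (h.odd (i := k - 2) (by omega) (by omega) hx hy).symm.cons hu huy
    rwa [show 2 * (k - 2) + 1 + 1 = 2 * k - 2 by omega] at this
  rw [mem_extendPart] at ha hb
  rcases ha with ha | ⟨ha, ha2⟩ <;> rcases hb with hb | ⟨hb, hb2⟩
  · refine ((h.isHub (by omega)).even_left a ha b hb hab).mono ?_
    exact (subset_insert _ _).trans (subset_insert _ _)
  · exact (hone b hb hb2 a ha).symm.mono (subset_insert _ _)
  · exact (hone a ha ha2 b hb).mono (insert_subset_insert _ (subset_insert _ _))
  · obtain ⟨y, hy, hay, -⟩ := exists_adj_ne_of_two_le ha2 b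
    obtain ⟨z, hz, hbz, hzy⟩ := exists_adj_ne_of_two_le hb2 y
    have h1 := h.symm.even (i := k - 2) (by omega) (by omega) hy hz hzy.symm
    rw [union_comm] at h1
    have h2 := (h1.symm.cons hb hbz).symm.cons (u := a)
      (by rw [mem_insert, not_or]; exact ⟨hab, ha⟩) hay
    rwa [show 2 * (k - 2) + 1 + 1 = 2 * k - 2 by omega] at h2

theorem odd_extendPart (h : G.IsCore k X Y) (hk : 3 ≤ k) {a b : V} (ha : a ∈ G.extendPart X Y)
    (hb : b ∈ G.extendPart Y X) (hab : a ≠ b) :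
    G.PathIn (2 * k - 1) (insert a (insert b (X ∪ Y))) a b := by
  rw [mem_extendPart] at ha hb
  rcases ha with ha | ⟨ha, ha2⟩ <;> rcases hb with hb | ⟨hb, hb2⟩
  · refine ((h.isHub (by omega)).odd a ha b hb).mono ?_
    exact (subset_insert _ _).trans (subset_insert _ _)
  · obtain ⟨x, hx, hbx, hxa⟩ := exists_adj_ne_of_two_le hb2 a
    rw [union_comm] at hb
    have := ((h.even (i := k - 1) (by omega) (by omega) hx ha hxa).cons hb hbx).symm
    rw [show 2 * (k - 1) + 1 = 2 * k - 1 by omega] at this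
    exact this.mono (subset_insert _ _)
  · obtain ⟨y, hy, hay, hyb⟩ := exists_adj_ne_of_two_le ha2 b
    have := h.symm.even (i := k - 1) (by omega) (by omega) hy hb hyb
    rw [union_comm] at this
    have := this.cons ha hay
    rw [show 2 * (k - 1) + 1 = 2 * k - 1 by omega] at this
    exact this.mono (insert_subset_insert _ (subset_insert _ _))
  · obtain ⟨y, hy, hay, -⟩ := exists_adj_ne_of_two_le ha2 b
    obtain ⟨x, hx, hbx, -⟩ := exists_adj_ne_of_two_le hb2 a
    rw [union_comm] at hb
    have h1 := h.odd (i := k - 2) (by omega) (by omega) hx hy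
    have h2 := (h1.cons hb hbx).symm.cons (u := a)
      (by rw [mem_insert, not_or]; exact ⟨hab, ha⟩) hay
    rwa [show 2 * (k - 2) + 1 + 1 + 1 = 2 * k - 1 by omega] at h2

theorem isHub_extendPart (h : G.IsCore k X Y) (hk : 3 ≤ k)
    (hfree : (cycleGraph (2 * k + 1)).Free G) :
    G.IsHub k (G.extendPart X Y) (G.extendPart Y X) := by
  have hd : Disjoint (G.extendPart X Y) (G.extendPart Y X) := by
    rw [Finset.disjoint_left]
    intro u hu hu'
    rw [mem_extendPart] at hu hu'
    rw [union_comm] at hu'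
    rcases hu with hu | ⟨hu, hu2⟩ <;> rcases hu' with hu' | ⟨hu', hu2'⟩
    · exact Finset.disjoint_left.1 h.disjoint hu hu'
    · exact hu' (mem_union_left _ hu)
    · exact hu (mem_union_right _ hu')
    · obtain ⟨y, hy, huy, -⟩ := exists_adj_ne_of_two_le hu2 u
      obtain ⟨x, hx, hux, -⟩ := exists_adj_ne_of_two_le hu2' u
      exact (h.isHub (by omega)).not_adj_both (by omega) hfree hu hx hy hux huy
  have hsub : X ∪ Y ⊆ G.extendPart X Y ∪ G.extendPart Y X :=
    union_subset_union subset_extendPart subset_extendPart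
  refine ⟨hd, h.indep_extendPart (by omega) hfree, h.symm.indep_extendPart (by omega) hfree,
    fun a ha b hb hab => ?_, fun a ha b hb hab => ?_, fun a ha b hb => ?_⟩
  · exact (h.even_extendPart hk ha hb hab).mono (insert_subset (mem_union_left _ ha)
      (insert_subset (mem_union_left _ hb) hsub))
  · have := h.symm.even_extendPart hk ha hb hab
    rw [union_comm Y X] at this
    exact this.mono (insert_subset (mem_union_right _ ha)
      (insert_subset (mem_union_right _ hb) hsub))
  · exact (h.odd_extendPart hk ha hb fun hab => Finset.disjoint_left.1 hd ha (hab ▸ hb)).mono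
      (insert_subset (mem_union_left _ ha) (insert_subset (mem_union_right _ hb) hsub))

end IsCore
end SimpleGraph

/-! ### Greedy colouring and compatibility with the hub. -/

namespace SimpleGraph
variable {V : Type*} {G : SimpleGraph V}

/-- The subgraph on `W` becomes bipartite after deleting at most `b` edges. -/
def BipartiteUpTo (G : SimpleGraph V) (W : Finset V) (b : ℕ) : Prop :=
  ∃ (c : V → Bool) (E : Finset (Sym2 V)), (E : Set (Sym2 V)) ⊆ G.edgeSet ∧ #E ≤ b ∧
    ∀ u ∈ W, ∀ v ∈ W, G.Adj u v → c u ≠ c v ∨ s(u, v) ∈ E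

theorem BipartiteUpTo.mono {W : Finset V} {b b' : ℕ} (h : G.BipartiteUpTo W b) (hb : b ≤ b') :
    G.BipartiteUpTo W b' := by
  obtain ⟨c, E, hE, hc, h⟩ := h
  exact ⟨c, E, hE, hc.trans hb, h⟩

theorem BipartiteUpTo.exists_deleteEdges [Fintype V] {b : ℕ} (h : G.BipartiteUpTo univ b) :
    ∃ E : Finset (Sym2 V), (E : Set (Sym2 V)) ⊆ G.edgeSet ∧ #E ≤ b ∧
      (G.deleteEdges (E : Set (Sym2 V))).IsBipartite := by
  obtain ⟨c, E, hE, hb, h⟩ := h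
  refine ⟨E, hE, hb, ?_⟩
  have col : (G.deleteEdges (E : Set (Sym2 V))).Coloring Bool := Coloring.mk c fun {u v} huv => by
    rw [deleteEdges_adj] at huv
    exact (h u (mem_univ _) v (mem_univ _) huv.1).resolve_right (by simpa using huv.2)
  exact col.colorable

theorem BipartiteUpTo.gamma2_le [Fintype V] {b : ℕ} (h : G.BipartiteUpTo univ b) :
    gamma2 G ≤ b := by
  obtain ⟨E, hE, hb, h⟩ := h.exists_deleteEdges
  exact le_trans (Nat.sInf_le ⟨E, hE, rfl, h⟩) hb

variable [DecidableEq V]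

/-- A new vertex can be coloured so that at most half of its edges become monochromatic. -/
theorem BipartiteUpTo.insert [DecidableRel G.Adj] {W : Finset V} {b : ℕ} (h : G.BipartiteUpTo W b)
    {u : V} (hu : u ∉ W) : G.BipartiteUpTo (insert u W) (b + #{w ∈ W | G.Adj u w} / 2) := by
  obtain ⟨c, E, hE, hb, h⟩ := h
  obtain ⟨α, hα⟩ : ∃ α, #{w ∈ {w ∈ W | G.Adj u w} | c w = α} ≤ #{w ∈ W | G.Adj u w} / 2 := by
    have h1 := card_filter_add_card_filter_not (s := {w ∈ W | G.Adj u w}) (fun w => c w = true)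
    simp only [Bool.not_eq_true] at h1
    by_contra! hcon
    have h2 := hcon true
    have h3 := hcon false
    omega
  refine ⟨Function.update c u α,
    E ∪ {w ∈ {w ∈ W | G.Adj u w} | c w = α}.image (fun w => s(u, w)), ?_, ?_, ?_⟩
  · intro e he
    simp only [coe_union, coe_image, Set.mem_union, Set.mem_image, mem_coe, mem_filter] at he
    rcases he with he | ⟨w, hw, rfl⟩
    · exact hE he
    · exact hw.1.2
  · exact (card_union_le _ _).trans (add_le_add hb (card_image_le.trans hα))
  · have key : ∀ w ∈ W, G.Adj u w → Function.update c u α u ≠ Function.update c u α w ∨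
        s(u, w) ∈ E ∪ {w ∈ {w ∈ W | G.Adj u w} | c w = α}.image (fun w => s(u, w)) := by
      intro w hw huw
      rw [Function.update_self, Function.update_of_ne huw.ne']
      by_cases hcw : c w = α
      · exact Or.inr (mem_union_right _ (mem_image_of_mem _ (by simp [hw, huw, hcw])))
      · exact Or.inl (Ne.symm hcw)
    intro v hv w hw hvw
    rcases mem_insert.1 hv with rfl | hv'
    · exact key w ((mem_insert.1 hw).resolve_left hvw.ne') hvw
    · rcases mem_insert.1 hw with rfl | hw'
      · rw [ne_comm, Sym2.eq_swap]
        exact key v hv' hvw.symm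
      · rw [Function.update_of_ne (ne_of_mem_of_not_mem hv' hu),
          Function.update_of_ne (ne_of_mem_of_not_mem hw' hu)]
        exact (h v hv' w hw' hvw).imp_right (mem_union_left _)

/-- The increment is the greedy cost of a vertex with at most `N` coloured neighbours outside the
hub and one inside, so the total cost telescopes. -/
theorem sq_div_four_succ (N : ℕ) : (N + 1) ^ 2 / 4 = N ^ 2 / 4 + (N + 1) / 2 := by
  obtain ⟨a, rfl | rfl⟩ := N.even_or_odd'
  · ring_nf
    omega
  · ring_nf
    omega

/-- Adding vertices one at a time to a bipartite piece `C ∪ U`, each with at most one neighbour in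
`C`. -/
theorem BipartiteUpTo.union [DecidableRel G.Adj] {C U : Finset V}
    (h : G.BipartiteUpTo (C ∪ U) 0) (R : Finset V) (hd : Disjoint (C ∪ U) R)
    (hR : ∀ u ∈ R, #{c ∈ C | G.Adj u c} ≤ 1) :
    G.BipartiteUpTo (C ∪ U ∪ R) ((#U + #R) ^ 2 / 4 - #U ^ 2 / 4) := by
  induction R using Finset.induction_on with
  | empty => simpa using h
  | insert u R hu ih =>
    rw [disjoint_insert_right] at hd
    have h1 := ih hd.2 fun v hv => hR v (mem_insert_of_mem hv)
    have h2 := h1.insert (u := u) (by rw [mem_union, not_or]; exact ⟨hd.1, hu⟩)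
    rw [union_insert]
    refine h2.mono ?_
    have h3 : #{w ∈ C ∪ U ∪ R | G.Adj u w} ≤ 1 + #U + #R := by
      rw [filter_union, filter_union]
      refine (card_union_le _ _).trans (add_le_add ((card_union_le _ _).trans (add_le_add
        (hR u (mem_insert_self _ _)) (card_filter_le _ _))) (card_filter_le _ _))
    rw [card_insert_of_notMem hu, ← add_assoc, sq_div_four_succ]
    have h4 : #U ^ 2 / 4 ≤ (#U + #R) ^ 2 / 4 :=
      Nat.div_le_div_right (Nat.pow_le_pow_left (by omega) 2)
    omega

/-- Colouring the vertices outside `C ∪ U` greedily, starting from a set `U`. -/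
theorem BipartiteUpTo.to_univ [Fintype V] [DecidableRel G.Adj] {C U : Finset V}
    (h0 : G.BipartiteUpTo (C ∪ U) 0) (hU : U ⊆ Cᶜ)
    (hU1 : ∀ u ∉ C, 2 ≤ #{c ∈ C | G.Adj u c} → u ∈ U) :
    G.BipartiteUpTo univ (#Cᶜ ^ 2 / 4 - #U ^ 2 / 4) := by
  have h1 := h0.union (Cᶜ \ U) (by
      rw [Finset.disjoint_left]
      intro v hv
      simp only [mem_sdiff, mem_compl] at *
      rw [mem_union] at hv
      tauto) (fun u hu => by
      simp only [mem_sdiff, mem_compl] at hu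
      by_contra hcon
      exact hu.2 (hU1 u hu.1 (by omega)))
  have h2 : #U + #(Cᶜ \ U) = #Cᶜ := by
    have := card_sdiff_add_card_eq_card hU
    omega
  have h3 : C ∪ U ∪ Cᶜ \ U = univ := by
    rw [union_assoc, union_sdiff_of_subset hU, union_compl]
  rwa [h2, h3] at h1

namespace IsHub
variable {k : ℕ} {X Y : Finset V}

/-- A colour of `u` that agrees with the bipartition of the hub. -/
def Compat (G : SimpleGraph V) (X Y : Finset V) (u : V) (α : Bool) : Prop :=
  (∀ x ∈ X, G.Adj u x → α = false) ∧ ∀ y ∈ Y, G.Adj u y → α = true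

theorem bipartiteUpTo_zero (h : G.IsHub k X Y) {U : Finset V} (hU : ∀ u ∈ U, u ∉ X ∪ Y)
    (c : V → Bool) (hc : ∀ u ∈ U, Compat G X Y u (c u))
    (hcU : ∀ u ∈ U, ∀ v ∈ U, G.Adj u v → c u ≠ c v) : G.BipartiteUpTo (X ∪ Y ∪ U) 0 := by
  have hXY : ∀ y ∈ Y, y ∉ X := fun y hy hx => Finset.disjoint_left.1 h.disjoint hx hy
  have hX : ∀ u ∈ U, u ∉ X := fun u hu hx => hU u hu (mem_union_left _ hx)
  have hY : ∀ u ∈ U, u ∉ Y := fun u hu hy => hU u hu (mem_union_right _ hy)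
  refine ⟨fun v => if v ∈ X then true else if v ∈ Y then false else c v, ∅, by simp, by simp,
    fun u hu v hv huv => Or.inl ?_⟩
  rw [mem_union, mem_union] at hu hv
  rcases hu with (hu | hu) | hu <;> rcases hv with (hv | hv) | hv
  · exact absurd huv (h.indep_left u hu v hv)
  · simp [hu, hv, hXY v hv]
  · simp [hu, hX v hv, hY v hv, (hc v hv).1 u hu huv.symm]
  · simp [hu, hv, hXY u hu]
  · exact absurd huv (h.indep_right u hu v hv)
  · simp [hu, hXY u hu, hX v hv, hY v hv, (hc v hv).2 u hu huv.symm]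
  · simp [hv, hX u hu, hY u hu, (hc u hu).1 v hv huv]
  · simp [hv, hXY v hv, hX u hu, hY u hu, (hc u hu).2 v hv huv]
  · simpa [hX u hu, hY u hu, hX v hv, hY v hv] using hcU u hu v hv huv

theorem exists_compat (h : G.IsHub k X Y) (hk : 2 ≤ k) (hfree : (cycleGraph (2 * k + 1)).Free G)
    {u : V} (hu : u ∉ X ∪ Y) : ∃ α, Compat G X Y u α := by
  by_cases hx : ∃ x ∈ X, G.Adj u x
  · obtain ⟨x, hx, hux⟩ := hx
    exact ⟨false, fun _ _ _ => rfl,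
      fun y hy huy => absurd huy (h.not_adj_both hk hfree hu hx hy hux)⟩
  · push Not at hx
    exact ⟨true, fun x hxX hux => absurd hux (hx x hxX), fun _ _ _ => rfl⟩

/-- Adjacent vertices of equal forced colour attach to the same part, and having two neighbours each
they can do so at distinct points, against `eq_of_adj_left` or `eq_of_adj_right`. -/
theorem bipartiteUpTo_zero_of_two_le [DecidableRel G.Adj] (h : G.IsHub k X Y) (hk : 2 ≤ k)
    (hfree : (cycleGraph (2 * k + 1)).Free G) {U : Finset V} (hU : ∀ u ∈ U, u ∉ X ∪ Y)
    (hU2 : ∀ u ∈ U, 2 ≤ #{c ∈ X ∪ Y | G.Adj u c}) : G.BipartiteUpTo (X ∪ Y ∪ U) 0 := by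
  have hex : ∀ u : V, ∃ α, u ∈ U → Compat G X Y u α := fun u => by
    by_cases hu : u ∈ U
    · obtain ⟨α, hα⟩ := h.exists_compat hk hfree (hU u hu)
      exact ⟨α, fun _ => hα⟩
    · exact ⟨true, fun h => absurd h hu⟩
  choose c hc using hex
  refine h.bipartiteUpTo_zero hU c hc fun u hu v hv huv hcc => ?_
  obtain ⟨a, ha, hua, -⟩ := exists_adj_ne_of_two_le (hU2 u hu) u
  obtain ⟨b, hb, hvb, hba⟩ := exists_adj_ne_of_two_le (hU2 v hv) a
  rcases mem_union.1 ha with ha | ha <;> rcases mem_union.1 hb with hb | hb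
  · exact hba (h.eq_of_adj_left hk hfree (hU u hu) (hU v hv) huv ha hb hua hvb).symm
  · have h1 := (hc u hu).1 a ha hua
    have h2 := (hc v hv).2 b hb hvb
    simp_all
  · have h1 := (hc u hu).2 a ha hua
    have h2 := (hc v hv).1 b hb hvb
    simp_all
  · exact hba (h.eq_of_adj_right hk hfree (hU u hu) (hU v hv) huv ha hb hua hvb).symm

/-- If no compatible colours separate `u` and `v`, they are adjacent and each is forced to the same
colour by a neighbour in the same part. `eq_of_adj_left` or `eq_of_adj_right` then merges all their
hub neighbours into one vertex. -/
theorem bipartiteUpTo_pair_or (h : G.IsHub k X Y) (hk : 2 ≤ k)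
    (hfree : (cycleGraph (2 * k + 1)).Free G) {u v : V} (hu : u ∉ X ∪ Y) (hv : v ∉ X ∪ Y)
    (huv : u ≠ v) : G.BipartiteUpTo (X ∪ Y ∪ {u, v}) 0 ∨ G.Adj u v ∧
      ∃ w ∈ X ∪ Y, ∀ c ∈ X ∪ Y, (G.Adj u c ↔ c = w) ∧ (G.Adj v c ↔ c = w) := by
  by_cases hex : ∃ α β, Compat G X Y u α ∧ Compat G X Y v β ∧ (G.Adj u v → α ≠ β)
  · left
    obtain ⟨α, β, hα, hβ, hαβ⟩ := hex
    refine h.bipartiteUpTo_zero (by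
        intro w hw
        rcases mem_insert.1 hw with rfl | hw
        · exact hu
        · rwa [mem_singleton.1 hw])
      (fun w => if w = u then α else β) (by simp [hα, hβ, huv.symm]) ?_
    simp [huv.symm]
    refine ⟨hαβ, fun h => (hαβ h.symm).symm⟩
  right
  push Not at hex
  obtain ⟨α, hα⟩ := h.exists_compat hk hfree hu
  obtain ⟨β, hβ⟩ := h.exists_compat hk hfree hv
  obtain ⟨hadj, rfl⟩ := hex α β hα hβ
  have hu' : ¬ Compat G X Y u (!α) := fun h' => by simpa using (hex _ _ h' hβ).2
  have hv' : ¬ Compat G X Y v (!α) := fun h' => by simpa using (hex _ _ hα h').2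
  refine ⟨hadj, ?_⟩
  cases α with
  | true =>
    simp only [Compat, Bool.not_true, implies_true, true_and, Bool.false_eq_true, imp_false,
      not_forall, not_not, exists_prop] at hu' hv'
    obtain ⟨a, ha, hua⟩ := hu'
    obtain ⟨b, hb, hvb⟩ := hv'
    have hab := h.eq_of_adj_right hk hfree hu hv hadj ha hb hua hvb
    subst hab
    refine ⟨a, mem_union_right _ ha, fun c hc => ⟨⟨fun huc => ?_, fun e => e ▸ hua⟩,
      fun hvc => ?_, fun e => e ▸ hvb⟩⟩
    · have hcY : c ∈ Y := (mem_union.1 hc).resolve_left fun hcX => by simpa using hα.1 c hcX huc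
      exact h.eq_of_adj_right hk hfree hu hv hadj hcY hb huc hvb
    · have hcY : c ∈ Y := (mem_union.1 hc).resolve_left fun hcX => by simpa using hβ.1 c hcX hvc
      exact (h.eq_of_adj_right hk hfree hu hv hadj ha hcY hua hvc).symm
  | false =>
    simp only [Compat, Bool.not_false, implies_true, and_true, Bool.true_eq_false, imp_false,
      not_forall, not_not, exists_prop] at hu' hv'
    obtain ⟨a, ha, hua⟩ := hu'
    obtain ⟨b, hb, hvb⟩ := hv'
    have hab := h.eq_of_adj_left hk hfree hu hv hadj ha hb hua hvb
    subst hab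
    refine ⟨a, mem_union_left _ ha, fun c hc => ⟨⟨fun huc => ?_, fun e => e ▸ hua⟩,
      fun hvc => ?_, fun e => e ▸ hvb⟩⟩
    · have hcX : c ∈ X := (mem_union.1 hc).resolve_right fun hcY => by simpa using hα.2 c hcY huc
      exact h.eq_of_adj_left hk hfree hu hv hadj hcX hb huc hvb
    · have hcX : c ∈ X := (mem_union.1 hc).resolve_right fun hcY => by simpa using hβ.2 c hcY hvc
      exact (h.eq_of_adj_left hk hfree hu hv hadj ha hcX hua hvc).symm

end IsHub
end SimpleGraph

/-! ### At most `r - 1` vertices outside the hub; cliques bound `gamma2` below. -/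

namespace SimpleGraph
variable {V : Type*} {G : SimpleGraph V} [Fintype V] [DecidableEq V] [DecidableRel G.Adj]

/-- The edges of `G` counted according to how many ends they have in `C`. -/
theorem two_mul_card_edgeFinset_eq (C : Finset V) :
    2 * #G.edgeFinset = ∑ u ∈ C, #{c ∈ C | G.Adj u c} + 2 * ∑ u ∈ Cᶜ, #{c ∈ C | G.Adj u c} +
      ∑ u ∈ Cᶜ, #{c ∈ Cᶜ | G.Adj u c} := by
  have h1 : ∑ u ∈ C, #{c ∈ Cᶜ | G.Adj u c} = ∑ u ∈ Cᶜ, #{c ∈ C | G.Adj u c} := by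
    simp only [card_filter]
    rw [sum_comm]
    simp only [G.adj_comm]
  have h2 : ∀ u : V, #{c | G.Adj u c} = #{c ∈ C | G.Adj u c} + #{c ∈ Cᶜ | G.Adj u c} := fun u => by
    simp only [card_filter]
    rw [sum_add_sum_compl]
  rw [← sum_card_filter_adj_univ, ← sum_add_sum_compl C]
  simp only [h2, sum_add_distrib, h1]
  ring

theorem card_filter_adj_le_two_of_notMem_extendPart {X Y : Finset V} {u : V}
    (hu : u ∉ G.extendPart X Y ∪ G.extendPart Y X) : #{c ∈ X ∪ Y | G.Adj u c} ≤ 2 := by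
  simp only [mem_union, IsCore.mem_extendPart, not_or, not_and, not_le] at hu
  have h1 := hu.1.2 ⟨hu.1.1, hu.2.1⟩
  have h2 := hu.2.2 ⟨hu.2.1, hu.1.1⟩
  rw [filter_union]
  have := card_union_le {c ∈ X | G.Adj u c} {c ∈ Y | G.Adj u c}
  omega

/-- With `s = r - 1 + j` and `j ≥ 1`, the squares differ by `j (2n - r - s + 1)`, while the other
terms are at most `j` times a quadratic in `r`. -/
theorem sq_add_lt_sq_of_le {r n s : ℤ} (hr : 1 ≤ r) (hs : s ≤ 10 * r) (hrs : r ≤ s)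
    (hn : 60 * (r + 2) ^ 2 ≤ n) :
    (n - s) ^ 2 + 4 * (s * (2 + 10 * r)) + 2 * (s * s) + 3 < (n - r + 1) ^ 2 := by
  obtain ⟨j, rfl⟩ : ∃ j : ℤ, s = r - 1 + j := ⟨s - r + 1, by ring⟩
  set s := r - 1 + j with hs_def
  have h8 : s ≤ j * r := by nlinarith [mul_nonneg (show 0 ≤ j - 1 by linarith) (sub_nonneg.2 hr)]
  have h9 : s * (4 * (2 + 10 * r) + 2 * s) ≤ j * r * (4 * (2 + 10 * r) + 20 * r) :=
    mul_le_mul h8 (by linarith) (by linarith) (mul_nonneg (by linarith) (by linarith))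
  have h10 : j * (r * (4 * (2 + 10 * r) + 20 * r) + 4) ≤ j * (2 * n - r - s + 1) :=
    mul_le_mul_of_nonneg_left (by nlinarith) (by linarith)
  have h11 : (n - r + 1) ^ 2 - (n - s) ^ 2 = j * (2 * n - r - s + 1) := by
    rw [hs_def]
    ring
  linarith

/-- The hub: all but at most `r - 1` vertices. -/
theorem exists_isHub {r k n : ℕ} (hr : 1 ≤ r) (hk : r + 4 ≤ 2 * k)
    (hn : 20 * (r + 2) ^ 2 * k ≤ n) (hV : Fintype.card V = n)
    (hfree : (cycleGraph (2 * k + 1)).Free G)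
    (he : (n - r + 1) ^ 2 / 4 + r.choose 2 ≤ #G.edgeFinset) :
    ∃ X Y : Finset V, G.IsHub k X Y ∧ #(X ∪ Y)ᶜ ≤ r - 1 := by
  obtain ⟨X₀, Y₀, h, hcard⟩ := exists_isCore hr hk hn hV hfree he
  have hH := h.isHub_extendPart (by omega) hfree
  have hle := fun u => card_filter_adj_le_two_of_notMem_extendPart (G := G) (X := X₀) (Y := Y₀)
    (u := u)
  have hsub : X₀ ∪ Y₀ ⊆ G.extendPart X₀ Y₀ ∪ G.extendPart Y₀ X₀ :=
    union_subset_union IsCore.subset_extendPart IsCore.subset_extendPart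
  refine ⟨_, _, hH, ?_⟩
  set X := G.extendPart X₀ Y₀
  set Y := G.extendPart Y₀ X₀
  have hC := card_add_card_compl (X ∪ Y)
  have hXY := card_union_of_disjoint hH.disjoint
  have h1 := sum_card_filter_adj_union_le hH.disjoint hH.indep_left hH.indep_right
  -- An outside vertex has at most one neighbour in each core part, and at most `10 r` hub vertices
  -- lie outside the core.
  have h2 : ∑ u ∈ (X ∪ Y)ᶜ, #{c ∈ X ∪ Y | G.Adj u c} ≤ #(X ∪ Y)ᶜ * (2 + 10 * r) := by
    rw [← smul_eq_mul]
    refine sum_le_card_nsmul _ _ _ fun u hu => ?_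
    have e1 := hle u (mem_compl.1 hu)
    have e2 : #{c ∈ X ∪ Y | G.Adj u c} ≤ #{c ∈ X₀ ∪ Y₀ | G.Adj u c} + #((X ∪ Y) \ (X₀ ∪ Y₀)) := by
      refine (card_le_card fun c hc => ?_).trans (card_union_le _ _)
      rw [mem_filter] at hc
      rw [mem_union, mem_filter, mem_sdiff]
      tauto
    have e3 := card_sdiff_add_card_eq_card hsub
    omega
  have h3 := sum_card_filter_adj_le_mul_self (G := G) (X ∪ Y)ᶜ
  have h4 := two_mul_card_edgeFinset_eq (G := G) (X ∪ Y)
  have hsub' := card_le_card hsub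
  rw [hV] at hC
  by_contra! hlt
  set s := #(X ∪ Y)ᶜ
  have hn1 : 60 * (r + 2) ^ 2 ≤ n := by nlinarith [show 3 ≤ k by omega]
  have he' : (n - r + 1) ^ 2 ≤ 4 * #G.edgeFinset + 3 := by omega
  have hrn : r ≤ n := by nlinarith
  have hs := sq_add_lt_sq_of_le (r := r) (n := n) (s := s) (by exact_mod_cast hr)
    (by zify at hsub' hcard hC; linarith) (by norm_cast; omega) (by exact_mod_cast hn1)
  have h5 : 4 * ((#X : ℤ) * #Y) ≤ (n - s) ^ 2 := by
    rw [hXY] at hC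
    zify at hC
    rw [show (n : ℤ) - s = #X + #Y by linarith]
    nlinarith [sq_nonneg ((#X : ℤ) - #Y)]
  zify [hrn] at h1 h2 h3 h4 he'
  linarith

theorem two_mul_choose_two_add_self (a : ℕ) : 2 * a.choose 2 + a = a ^ 2 := by
  induction a with
  | zero => rfl
  | succ a ih =>
    rw [Nat.choose_succ_succ' a 1, Nat.choose_one_right]
    nlinarith

theorem choose_two_add_choose_two (r : ℕ) :
    ((r + 1) / 2).choose 2 + (r / 2).choose 2 = (r - 1) ^ 2 / 4 := by
  obtain ⟨a, rfl | rfl⟩ := r.even_or_odd'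
  · rw [show (2 * a + 1) / 2 = a by omega, show 2 * a / 2 = a by omega]
    have h := two_mul_choose_two_add_self a
    obtain _ | b := a
    · rfl
    · rw [show 2 * (b + 1) - 1 = 2 * b + 1 by omega]
      ring_nf at h ⊢
      omega
  · rw [show (2 * a + 1 + 1) / 2 = a + 1 by omega, show (2 * a + 1) / 2 = a by omega,
      Nat.choose_succ_succ' a 1, Nat.choose_one_right, show 2 * a + 1 - 1 = 2 * a by omega]
    have h := two_mul_choose_two_add_self a
    ring_nf at h ⊢
    omega

/-- The right side counts the monochromatic edges of a clique split into classes of sizes `a` and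
`b`; when `a + b > 0`, four times it is `(a + b - 1)² + (a - b)² - 1`. -/
theorem sq_div_four_le_choose_two_add (a b : ℕ) :
    (a + b - 1) ^ 2 / 4 ≤ a.choose 2 + b.choose 2 := by
  have ha := two_mul_choose_two_add_self a
  have hb := two_mul_choose_two_add_self b
  obtain h0 | ⟨N, hN⟩ : a + b = 0 ∨ ∃ N, a + b = N + 1 := by
    cases h : a + b with
    | zero => exact Or.inl rfl
    | succ N => exact Or.inr ⟨N, rfl⟩
  · simp [h0]
  · rw [hN, Nat.add_sub_cancel]
    have h1 : N ^ 2 ≤ 4 * (a.choose 2 + b.choose 2) + 1 := by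
      zify at *
      have : (N : ℤ) = a + b - 1 := by linarith
      rw [this]
      nlinarith [sq_nonneg ((a : ℤ) - b)]
    omega

omit [DecidableRel G.Adj] in
/-- A lower bound on the number of edges to delete from a graph with a given clique. -/
theorem le_gamma2_of_isClique {K : Finset V} (hK : ∀ u ∈ K, ∀ v ∈ K, u ≠ v → G.Adj u v) :
    (#K - 1) ^ 2 / 4 ≤ gamma2 G := by
  obtain ⟨E, -, hE, ⟨c⟩⟩ := gamma2_spec G
  rw [← hE]
  have hsub : ∀ K' ⊆ K, (∀ u ∈ K', ∀ v ∈ K', c u = c v) → K'.offDiag.image Sym2.mk.uncurry ⊆ E := by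
    intro K' hK' hc e he
    obtain ⟨⟨u, v⟩, huv, rfl⟩ := mem_image.1 he
    rw [mem_offDiag] at huv
    by_contra hcon
    refine c.valid (v := u) (w := v) ?_ (hc u huv.1 v huv.2.1)
    rw [deleteEdges_adj]
    exact ⟨hK u (hK' huv.1) v (hK' huv.2.1) huv.2.2, by simpa using hcon⟩
  have h0 := hsub {u ∈ K | c u = 0} (filter_subset _ _) (by
    intro u hu v hv
    rw [(mem_filter.1 hu).2, (mem_filter.1 hv).2])
  have h1 := hsub {u ∈ K | ¬ c u = 0} (filter_subset _ _) (by
    intro u hu v hv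
    have := (mem_filter.1 hu).2
    have := (mem_filter.1 hv).2
    omega)
  have hd : Disjoint ({u ∈ K | c u = 0}.offDiag.image Sym2.mk.uncurry)
      ({u ∈ K | ¬ c u = 0}.offDiag.image Sym2.mk.uncurry) := by
    rw [Finset.disjoint_left]
    intro e he he'
    obtain ⟨⟨u, v⟩, huv, rfl⟩ := mem_image.1 he
    obtain ⟨⟨u', v'⟩, huv', h⟩ := mem_image.1 he'
    simp only [mem_offDiag, mem_filter] at huv huv'
    rcases Sym2.eq_iff.1 h with ⟨rfl, rfl⟩ | ⟨rfl, rfl⟩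
    · exact huv'.1.2 huv.1.2
    · exact huv'.1.2 huv.2.1.2
  have h2 := card_le_card (union_subset h0 h1)
  rw [card_union_of_disjoint hd, Sym2.card_image_offDiag, Sym2.card_image_offDiag] at h2
  rw [← card_filter_add_card_filter_not (s := K) (fun u => c u = 0)]
  exact (sq_div_four_le_choose_two_add _ _).trans h2

end SimpleGraph

/-! ### The equality case. -/

namespace SimpleGraph
variable {V : Type*} {G : SimpleGraph V} [Fintype V] [DecidableEq V] [DecidableRel G.Adj]

omit [Fintype V] in
theorem adj_of_two_mul_le_sum {X Y : Finset V} (hXY : Disjoint X Y)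
    (hX : ∀ u ∈ X, ∀ v ∈ X, ¬ G.Adj u v) (hY : ∀ u ∈ Y, ∀ v ∈ Y, ¬ G.Adj u v)
    (h : 2 * (#X * #Y) ≤ ∑ u ∈ X ∪ Y, #{c ∈ X ∪ Y | G.Adj u c}) {x y : V} (hx : x ∈ X)
    (hy : y ∈ Y) : G.Adj x y := by
  by_contra hxy
  rw [sum_union hXY] at h
  have hsub : ∀ u ∈ X, {c ∈ X ∪ Y | G.Adj u c} ⊆ Y := fun u hu c hc => by
    rw [mem_filter, mem_union] at hc
    exact hc.1.resolve_left fun h => hX u hu c h hc.2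
  have h1 : ∑ u ∈ X, #{c ∈ X ∪ Y | G.Adj u c} < ∑ u ∈ X, #Y := by
    refine sum_lt_sum (fun u hu => card_le_card (hsub u hu)) ⟨x, hx, card_lt_card ?_⟩
    exact (ssubset_iff_of_subset (hsub x hx)).2 ⟨y, hy, fun h => hxy (mem_filter.1 h).2⟩
  have h2 : ∑ u ∈ Y, #{c ∈ X ∪ Y | G.Adj u c} ≤ #Y * #X := by
    rw [← smul_eq_mul]
    refine sum_le_card_nsmul _ _ _ fun u hu => card_le_card fun c hc => ?_
    rw [mem_filter, mem_union] at hc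
    exact hc.1.resolve_right fun h => hY u hu c h hc.2
  rw [sum_const, smul_eq_mul] at h1
  linarith [mul_comm #X #Y]

theorem sq_div_four_eq_iff {a b : ℕ} (h : (a + b) ^ 2 / 4 ≤ a * b) :
    a * b = (a + b) ^ 2 / 4 ∧ (a = (a + b) / 2 ∧ b = (a + b + 1) / 2 ∨
      b = (a + b) / 2 ∧ a = (a + b + 1) / 2) := by
  rcases le_total a b with hab | hab
  · obtain ⟨d, rfl⟩ := Nat.exists_eq_add_of_le hab
    have h1 : (a + (a + d)) ^ 2 = 4 * (a * (a + d)) + d ^ 2 := by ring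
    rw [h1, Nat.mul_add_div (by norm_num)] at h ⊢
    have h2 : d < 2 := by
      by_contra! hd
      have : 4 ≤ d ^ 2 := by nlinarith
      omega
    interval_cases d
    · exact ⟨by norm_num, by omega⟩
    · exact ⟨by norm_num, by omega⟩
  · obtain ⟨d, rfl⟩ := Nat.exists_eq_add_of_le hab
    have h1 : (b + d + b) ^ 2 = 4 * ((b + d) * b) + d ^ 2 := by ring
    rw [h1, Nat.mul_add_div (by norm_num)] at h ⊢
    have h2 : d < 2 := by
      by_contra! hd
      have : 4 ≤ d ^ 2 := by nlinarith
      omega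
    interval_cases d
    · exact ⟨by norm_num, by omega⟩
    · exact ⟨by norm_num, by omega⟩

namespace IsHub
variable {k : ℕ} {X Y : Finset V}

/-- Outside the hub there are at most `(r - 1) + (r - 1).choose 2 = r.choose 2` edges. The hub, with
`n - r + 1` vertices where `n = |V|`, must therefore attain the bipartite maximum. -/
theorem isTStar (h : G.IsHub k X Y) {r : ℕ} (hS : #(X ∪ Y)ᶜ + 1 = r)
    (he : (Fintype.card V - r + 1) ^ 2 / 4 + r.choose 2 ≤ #G.edgeFinset) {w : V} (hw : w ∈ X ∪ Y)
    (hSw : ∀ u ∈ (X ∪ Y)ᶜ, ∀ c ∈ X ∪ Y, G.Adj u c ↔ c = w)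
    (hSS : ∀ u ∈ (X ∪ Y)ᶜ, ∀ v ∈ (X ∪ Y)ᶜ, u ≠ v → G.Adj u v) : IsTStar r G := by
  have h1 := two_mul_card_edgeFinset_eq (G := G) (X ∪ Y)
  have h2 : ∑ u ∈ (X ∪ Y)ᶜ, #{c ∈ X ∪ Y | G.Adj u c} ≤ #(X ∪ Y)ᶜ * 1 := by
    rw [← smul_eq_mul]
    refine sum_le_card_nsmul _ _ _ fun u hu => card_le_one.2 fun a ha b hb => ?_
    rw [mem_filter] at ha hb
    rw [(hSw u hu a ha.1).1 ha.2, (hSw u hu b hb.1).1 hb.2]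
  have h3 : ∑ u ∈ (X ∪ Y)ᶜ, #{c ∈ (X ∪ Y)ᶜ | G.Adj u c} ≤ #(X ∪ Y)ᶜ * (#(X ∪ Y)ᶜ - 1) := by
    rw [← smul_eq_mul]
    refine sum_le_card_nsmul _ _ _ fun u hu => ?_
    rw [← card_erase_of_mem hu]
    refine card_le_card fun c hc => ?_
    rw [mem_filter] at hc
    exact mem_erase.2 ⟨hc.2.ne', hc.1⟩
  have h4 := sum_card_filter_adj_union_le h.disjoint h.indep_left h.indep_right
  have hC := card_add_card_compl (X ∪ Y)
  have hXY := card_union_of_disjoint h.disjoint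
  have hpos : 0 < #(X ∪ Y) := card_pos.2 ⟨w, hw⟩
  have hN : Fintype.card V - r + 1 = #X + #Y := by omega
  rw [hN] at he
  have h5 := two_mul_choose_two_add_self r
  have h6 : #(X ∪ Y)ᶜ * (#(X ∪ Y)ᶜ - 1) + 2 * #(X ∪ Y)ᶜ + r = r ^ 2 := by
    rw [← hS]
    cases #(X ∪ Y)ᶜ with
    | zero => rfl
    | succ s => rw [Nat.add_sub_cancel]; ring
  obtain ⟨h7, h8⟩ := sq_div_four_eq_iff (a := #X) (b := #Y) (by omega)
  have hadj : ∀ x ∈ X, ∀ y ∈ Y, G.Adj x y := fun x hx y hy =>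
    adj_of_two_mul_le_sum h.disjoint h.indep_left h.indep_right (by omega) hx hy
  have hdX : Disjoint X (X ∪ Y)ᶜ := disjoint_compl_right.mono_left subset_union_left
  have hdY : Disjoint Y (X ∪ Y)ᶜ := disjoint_compl_right.mono_left subset_union_right
  have hcov : ∀ v, v ∈ X ∨ v ∈ Y ∨ v ∈ (X ∪ Y)ᶜ := fun v => by
    rw [mem_compl, mem_union]
    tauto
  have hmain : ∀ u v, G.Adj u v ↔ (u ∈ X ∧ v ∈ Y) ∨ (u ∈ Y ∧ v ∈ X) ∨
      (u ≠ v ∧ (u ∈ (X ∪ Y)ᶜ ∨ u = w) ∧ (v ∈ (X ∪ Y)ᶜ ∨ v = w)) := by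
    intro u v
    constructor
    · intro huv
      by_cases hu : u ∈ (X ∪ Y)ᶜ <;> by_cases hv : v ∈ (X ∪ Y)ᶜ
      · exact Or.inr (Or.inr ⟨huv.ne, Or.inl hu, Or.inl hv⟩)
      · exact Or.inr (Or.inr ⟨huv.ne, Or.inl hu,
          Or.inr ((hSw u hu v (not_not.1 (mt mem_compl.2 hv))).1 huv)⟩)
      · exact Or.inr (Or.inr ⟨huv.ne,
          Or.inr ((hSw v hv u (not_not.1 (mt mem_compl.2 hu))).1 huv.symm), Or.inl hv⟩)
      · rw [mem_compl, not_not, mem_union] at hu hv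
        rcases hu with hu | hu <;> rcases hv with hv | hv
        · exact absurd huv (h.indep_left u hu v hv)
        · exact Or.inl ⟨hu, hv⟩
        · exact Or.inr (Or.inl ⟨hu, hv⟩)
        · exact absurd huv (h.indep_right u hu v hv)
    · rintro (⟨hu, hv⟩ | ⟨hu, hv⟩ | ⟨hne, hu | rfl, hv | rfl⟩)
      · exact hadj u hu v hv
      · exact (hadj v hv u hu).symm
      · exact hSS u hu v hv hne
      · exact (hSw u hu _ hw).2 rfl
      · exact ((hSw v hv _ hw).2 rfl).symm
      · exact absurd rfl hne
  rcases h8 with ⟨hX, hY⟩ | ⟨hY, hX⟩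
  · exact ⟨X, Y, (X ∪ Y)ᶜ, w, h.disjoint, hdX, hdY, hcov, by omega, by omega, hS,
      mem_union.1 hw, hmain⟩
  · refine ⟨Y, X, (X ∪ Y)ᶜ, w, h.disjoint.symm, hdY, hdX, fun v => ?_, by omega, by omega, hS,
      (mem_union.1 hw).symm, fun u v => ?_⟩
    · have := hcov v
      tauto
    · rw [hmain, or_left_comm]

/-- A free set `U` lowers the greedy bound by `⌊|U|² / 4⌋`, so extremality forbids one with two
vertices that contains every vertex having two hub neighbours. -/
theorem isTStar_of_le_gamma2 (h : G.IsHub k X Y) (hk : 2 ≤ k)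
    (hfree : (cycleGraph (2 * k + 1)).Free G) {r : ℕ} (hr : 3 ≤ r) (hS : #(X ∪ Y)ᶜ ≤ r - 1)
    (he : (Fintype.card V - r + 1) ^ 2 / 4 + r.choose 2 ≤ #G.edgeFinset)
    (hγ : (r - 1) ^ 2 / 4 ≤ gamma2 G) : IsTStar r G := by
  obtain ⟨t, rfl⟩ : ∃ t, r = t + 3 := ⟨r - 3, by omega⟩
  rw [show t + 3 - 1 = t + 1 + 1 by omega] at hγ hS
  have hmono : #(X ∪ Y)ᶜ ^ 2 / 4 ≤ (t + 1 + 1) ^ 2 / 4 :=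
    Nat.div_le_div_right (Nat.pow_le_pow_left hS 2)
  -- As `r ≥ 3`, the bound grows strictly from `r - 2` to `r - 1` outside vertices, which forces
  -- `|S| = r - 1`.
  have hs1 := sq_div_four_succ (t + 1)
  have hcard : ∀ U ⊆ (X ∪ Y)ᶜ, (∀ u ∉ X ∪ Y, 2 ≤ #{c ∈ X ∪ Y | G.Adj u c} → u ∈ U) →
      G.BipartiteUpTo (X ∪ Y ∪ U) 0 → #U < 2 := by
    intro U hU hU1 h0
    by_contra! hlt
    have h1 := (h0.to_univ hU hU1).gamma2_le
    have h2 : 4 ≤ #U ^ 2 := by nlinarith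
    omega
  set U₀ : Finset V := {u | u ∉ X ∪ Y ∧ 2 ≤ #{c ∈ X ∪ Y | G.Adj u c}} with hU₀
  have hU₀m : ∀ u, u ∈ U₀ ↔ u ∉ X ∪ Y ∧ 2 ≤ #{c ∈ X ∪ Y | G.Adj u c} := fun u => by
    rw [hU₀, mem_filter]
    simp
  have hU₀0 : G.BipartiteUpTo (X ∪ Y ∪ U₀) 0 := h.bipartiteUpTo_zero_of_two_le hk hfree
    (fun u hu => ((hU₀m u).1 hu).1) (fun u hu => ((hU₀m u).1 hu).2)
  have hU₀S : U₀ ⊆ (X ∪ Y)ᶜ := fun u hu => mem_compl.2 ((hU₀m u).1 hu).1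
  have hU₀2 : #U₀ < 2 := hcard U₀ hU₀S (fun u hu hu2 => (hU₀m u).2 ⟨hu, hu2⟩) hU₀0
  have hScard : #(X ∪ Y)ᶜ = t + 1 + 1 := by
    by_contra hne
    have h1 := (hU₀0.to_univ hU₀S fun u hu hu2 => (hU₀m u).2 ⟨hu, hu2⟩).gamma2_le
    have h2 : #(X ∪ Y)ᶜ ^ 2 / 4 ≤ (t + 1) ^ 2 / 4 :=
      Nat.div_le_div_right (Nat.pow_le_pow_left (by omega) 2)
    omega
  have hpair : ∀ u ∈ (X ∪ Y)ᶜ, ∀ v ∈ (X ∪ Y)ᶜ, u ≠ v → U₀ ⊆ {u, v} → G.Adj u v ∧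
      ∃ w ∈ X ∪ Y, ∀ c ∈ X ∪ Y, (G.Adj u c ↔ c = w) ∧ (G.Adj v c ↔ c = w) := by
    intro u hu v hv huv hsub
    refine (h.bipartiteUpTo_pair_or hk hfree (mem_compl.1 hu) (mem_compl.1 hv)
      huv).resolve_left fun h0 => ?_
    have := hcard {u, v} (insert_subset hu (singleton_subset_iff.2 hv))
      (fun a ha ha2 => hsub ((hU₀m a).2 ⟨ha, ha2⟩)) h0
    rw [card_pair huv] at this
    omega
  -- If `U₀ = {u}`, pairing `u` with any other outside vertex would leave it only one hub neighbour.
  have hU₀e : U₀ = ∅ := by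
    by_contra hne
    obtain ⟨u, hu⟩ := nonempty_iff_ne_empty.2 hne
    obtain ⟨v, hv, hvu⟩ := exists_mem_ne (s := (X ∪ Y)ᶜ) (by omega) u
    obtain ⟨-, w, -, hw⟩ := hpair u (hU₀S hu) v hv hvu.symm fun a ha => by
      rw [card_le_one.1 (by omega : #U₀ ≤ 1) a ha u hu]
      simp
    have h2 := ((hU₀m u).1 hu).2
    have h3 : #{c ∈ X ∪ Y | G.Adj u c} ≤ 1 := card_le_one.2 fun a ha b hb => by
      rw [mem_filter] at ha hb
      rw [((hw a ha.1).1).1 ha.2, ((hw b hb.1).1).1 hb.2]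
    omega
  simp only [hU₀e, empty_subset, forall_const] at hpair
  obtain ⟨u, hu⟩ : ((X ∪ Y)ᶜ).Nonempty := card_pos.1 (by omega)
  obtain ⟨v, hv, hvu⟩ := exists_mem_ne (s := (X ∪ Y)ᶜ) (by omega) u
  obtain ⟨-, w, hw, hwuv⟩ := hpair u hu v hv hvu.symm
  refine h.isTStar (by omega) he hw (fun a ha c hc => ?_)
    fun a ha b hb hab => (hpair a ha b hb hab).1
  by_cases hau : a = u
  · rw [hau]
    exact (hwuv c hc).1
  · obtain ⟨-, w', hw', hwau⟩ := hpair a ha u hu hau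
    -- The unique hub neighbour of `u` is shared with every other outside vertex, so it is the same
    -- for all.
    have : w = w' := (hwau w hw).2.1 ((hwuv w hw).1.2 rfl)
    rw [this]
    exact (hwau c hc).1

end IsHub

omit [DecidableRel G.Adj] in
theorem le_gamma2_of_isTStar {r : ℕ} (h : IsTStar r G) : (r - 1) ^ 2 / 4 ≤ gamma2 G := by
  obtain ⟨A, B, C, x, -, hAC, hBC, -, -, -, hC, hx, hadj⟩ := h
  have hxC : x ∉ C := fun hxC => hx.elim (fun h => Finset.disjoint_left.1 hAC h hxC)
    fun h => Finset.disjoint_left.1 hBC h hxC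
  have hK : #(insert x C) = r := by rw [card_insert_of_notMem hxC, hC]
  rw [← hK]
  refine le_gamma2_of_isClique fun u hu v hv huv => (hadj u v).2 (Or.inr (Or.inr ⟨huv, ?_, ?_⟩))
  · exact (mem_insert.1 hu).symm
  · exact (mem_insert.1 hv).symm

end SimpleGraph

/-! ### Assembly. -/

open SimpleGraph

theorem mainTheorem2 {V : Type*} [Fintype V] [DecidableEq V] (G : SimpleGraph V)
    [DecidableRel G.Adj] (r k n : ℕ) (hr : 1 ≤ r) (hk : r + 4 ≤ 2 * k)
    (hn : 20 * (r + 2) ^ 2 * k ≤ n) (hV : Fintype.card V = n)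
    (hfree : (SimpleGraph.cycleGraph (2 * k + 1)).Free G)
    (he : (n - r + 1) ^ 2 / 4 + r.choose 2 ≤ G.edgeFinset.card) :
    (∃ T : Finset V, T.card ≤ r - 1 ∧ (G.induce {v | v ∉ T}).IsBipartite) ∧
    d2 G ≤ r - 1 ∧
    (∃ E : Finset (Sym2 V), (E : Set (Sym2 V)) ⊆ G.edgeSet ∧
      E.card ≤ ((r + 1) / 2).choose 2 + (r / 2).choose 2 ∧
      (G.deleteEdges (E : Set (Sym2 V))).IsBipartite) ∧
    gamma2 G ≤ ((r + 1) / 2).choose 2 + (r / 2).choose 2 ∧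
    (3 ≤ r → (gamma2 G = ((r + 1) / 2).choose 2 + (r / 2).choose 2 ↔ IsTStar r G)) := by
  obtain ⟨X, Y, h, hS⟩ := exists_isHub hr hk hn hV hfree he
  rw [choose_two_add_choose_two]
  have hT : (G.induce {v | v ∉ (X ∪ Y)ᶜ}).IsBipartite := by
    have col : (G.induce {v | v ∉ (X ∪ Y)ᶜ}).Coloring Bool :=
      Coloring.mk (fun v => decide (v.1 ∈ X)) fun {u v} huv heq => by
        have hu : u.1 ∈ X ∪ Y := not_not.1 (mt mem_compl.2 u.2)
        have hv : v.1 ∈ X ∪ Y := not_not.1 (mt mem_compl.2 v.2)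
        rw [decide_eq_decide] at heq
        by_cases huX : u.1 ∈ X
        · exact h.indep_left _ huX _ (heq.1 huX) huv
        · exact h.indep_right _ ((mem_union.1 hu).resolve_left huX) _
            ((mem_union.1 hv).resolve_left fun hvX => huX (heq.2 hvX)) huv
    exact col.colorable
  have hγ : G.BipartiteUpTo univ ((r - 1) ^ 2 / 4) := by
    have h0 := h.bipartiteUpTo_zero_of_two_le (by omega) hfree
      (U := ({u | u ∉ X ∪ Y ∧ 2 ≤ #{c ∈ X ∪ Y | G.Adj u c}} : Finset V))
      (fun u hu => (mem_filter.1 hu).2.1) (fun u hu => (mem_filter.1 hu).2.2)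
    refine (h0.to_univ (fun u hu => mem_compl.2 (mem_filter.1 hu).2.1)
      (fun u hu hu2 => mem_filter.2 ⟨mem_univ _, hu, hu2⟩)).mono ?_
    exact (Nat.sub_le _ _).trans (Nat.div_le_div_right (Nat.pow_le_pow_left hS 2))
  refine ⟨⟨_, hS, hT⟩, le_trans (b := #(X ∪ Y)ᶜ) (Nat.sInf_le ⟨_, rfl, hT⟩) hS, hγ.exists_deleteEdges, hγ.gamma2_le,
    fun hr3 => ⟨fun heq => ?_, fun hstar => ?_⟩⟩
  · exact h.isTStar_of_le_gamma2 (by omega) hfree hr3 hS (hV ▸ he) heq.ge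
  · exact le_antisymm hγ.gamma2_le (le_gamma2_of_isTStar hstar)
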